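/- For $\Re z>0$ put $\theta(z)=\sum_{n\in\mathbf Z}e^{-\pi n^2z}$ and $\psi(z)=\frac{\theta(z)-1}{2}=\sum_{n\ge1}e^{-\pi n^2z}$. Let $\mathcal L(s)$ be the entire function defined by $$\pi^{-s/2}\Gamma(\tfrac s2)\,\mathcal L(s)=-\frac1s+\int_1^\infty x^{s/2}\psi(x)\,\frac{dx}{x},$$ and put $\Lambda(s)=\pi^{-s/2}\Gamma(s/2)\mathcal L(s)$. Theorem. The function $F(s)=s\Lambda(s)=s\pi^{-s/2}\Gamma(s/2)\mathcal L(s)$ (continued to the removable singularities $s=0,-2,-4,\dots$) is an entire function of order $1$. It has exactly one real zero $b_0$, and $|b_0-11.25|<0.005$. It has infinitely many non-real zeros, and they come in complex conjugate pairs: the zeros of $F$, listed with multiplicity, can be numbered as $(b_n)_{n\in\mathbf Z}$ with $b_0$ the real zero, $b_n$ non-real for $n\neq0$, $b_{-n}=\overline{b_n}$, and $|b_n|\le|b_{n+1}|$ for $n\ge1$. The integral $\alpha=\int_1^\infty\psi(y)\,\frac{dy}{y}$ converges absolutely, and for every such numbering and every $s\in\mathbf C$ the product below converges unconditionally and $$F(s)=-e^{-\alpha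 s}\prod_{n\in\mathbf Z}\Bigl(1-\frac{s}{b_n}\Bigr)e^{s/b_n},$$ that is, for $s\ne0$, $$\Lambda(s)=-\frac{e^{-\alpha s}}{s}\prod_{n\in\mathbf Z}\Bigl(1-\frac{s}{b_n}\Bigr)e^{s/b_n}.$$ -/

import Mathlib

open Set MeasureTheory

noncomputable section

/-- The theta function `θ(z) = ∑_{n ∈ ℤ} exp(-π n² z)`, for `Re z > 0`. -/
def thetaFn (z : ℂ) : ℂ := ∑' n : ℤ, Complex.exp (-Real.pi * (n : ℂ) ^ 2 * z)

/-- `ψ(z) = (θ(z) - 1) / 2`, that is `∑_{n ≥ 1} exp(-π n² z)`, for `Re z > 0`. -/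
def psiFn (z : ℂ) : ℂ := (thetaFn z - 1) / 2

/-- The function `𝓛(τ, s)`, defined for `Re τ > 0` and all `s` by
`π^{-s/2} Γ(s/2) 𝓛(τ, s) = -τ^{s/2} / s + τ^{s/2} ∫_1^∞ x^{s/2} ψ(τ x) dx/x`.
To have the right values also at `s = 0, -2, -4, …`, the equation is divided by the Gamma factor
using `s Γ(s/2) = 2 Γ(s/2 + 1)`; Mathlib's `(Complex.Gamma w)⁻¹` is the entire function `1/Γ`. -/
def lavrikL (τ s : ℂ) : ℂ :=
  (Real.pi : ℂ) ^ (s / 2) * τ ^ (s / 2) *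
    (-(2 * Complex.Gamma (s / 2 + 1))⁻¹ +
      (Complex.Gamma (s / 2))⁻¹ * ∫ x in Ioi (1 : ℝ), (x : ℂ) ^ (s / 2) * psiFn (τ * x) / x)

/-- `Λ(s) = π^{-s/2} Γ(s/2) 𝓛(s)` with `𝓛(s) = 𝓛(1, s)`
(meaningful as it stands for `s ≠ 0, -2, -4, …`, the poles of the Gamma factor). -/
def lavrikLambda (s : ℂ) : ℂ :=
  (Real.pi : ℂ) ^ (-s / 2) * Complex.Gamma (s / 2) * lavrikL 1 s

/-- The defining equation of `𝓛(τ, s)`. -/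
theorem lavrikL_equation (τ s : ℂ) (hs : ∀ n : ℕ, s ≠ -2 * (n : ℂ)) :
    (Real.pi : ℂ) ^ (-s / 2) * Complex.Gamma (s / 2) * lavrikL τ s =
      -τ ^ (s / 2) / s +
        τ ^ (s / 2) * ∫ x in Ioi (1 : ℝ), (x : ℂ) ^ (s / 2) * psiFn (τ * x) / x := by
  have h0 : s ≠ 0 := by simpa using hs 0
  have hG : Complex.Gamma (s / 2) ≠ 0 := Complex.Gamma_ne_zero fun m hm => hs m (by
    rw [div_eq_iff two_ne_zero] at hm
    rw [hm]; ring)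
  have hp : (Real.pi : ℂ) ^ (s / 2) ≠ 0 := by
    simp [Complex.cpow_eq_zero_iff, Real.pi_ne_zero]
  rw [lavrikL, Complex.Gamma_add_one _ (div_ne_zero h0 two_ne_zero), neg_div, Complex.cpow_neg]
  field_simp

/-- The order of an entire function: the infimum of all `ρ ≥ 0` such that
`|f(z)| ≤ exp(|z|^ρ)` for all sufficiently large `|z|` (and `∞` if there is none). -/
def entireOrder (f : ℂ → ℂ) : ENNReal :=
  ⨅ (ρ : NNReal)
    (_ : ∀ᶠ z in Bornology.cobounded ℂ, ‖f z‖ ≤ Real.exp (‖z‖ ^ (ρ : ℝ))), (ρ : ENNReal)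

/-- `(b_n)_{n ∈ ℤ}` lists all zeros of `F`, each as often as its multiplicity, with `b_0` real,
`b_n` non-real for `n ≠ 0`, `b_{-n}` the complex conjugate of `b_n`, and `|b_n| ≤ |b_{n+1}|`
for `n ≥ 1`. -/
structure IsZeroNumbering (F : ℂ → ℂ) (b : ℤ → ℂ) : Prop where
  real_zero : (b 0).im = 0
  nonreal : ∀ n : ℤ, n ≠ 0 → (b n).im ≠ 0
  conj : ∀ n : ℤ, b (-n) = (starRingEnd ℂ) (b n)
  monotone : ∀ n : ℤ, 1 ≤ n → ‖b n‖ ≤ ‖b (n + 1)‖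
  multiplicity : ∀ z : ℂ, {n : ℤ | b n = z}.encard = analyticOrderAt F z

/-- `α = ∫_1^∞ ψ(y) dy/y`. -/
def lavrikAlpha : ℂ := ∫ y in Ioi (1 : ℝ), psiFn y / y

end

/-! Write F(s) = -1 + s I(s), where I(s) = ∫_1^∞ x^{s/2} ψ(x) dx/x is entire. Since ψ > 0, |I(s)| ≤
I(Re s), and on the real axis I(r) lies between `incGamma (r / 2)` and 10000/9999 times it. This
gives log |F(s)| ≤ |s| log |s| for |s| ≥ 4, while F(r) outgrows e^{Ar} for every A as r → +∞. Hence
the order is 1. Finitely many zeros would force exponential type by Hadamard's theorem, so there are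
infinitely many zeros.

For r ≤ 0 one has F(r) ≤ -1, and r I(r) increases strictly for r > 0. So there is one real zero, and
it is simple. It is located by bounding `incGamma` through its recursion a ↦ a + 1. The other zeros
come in conjugate pairs because F commutes with conjugation.

The product is Hadamard's factorization in genus one (`ListsZeros.eq_exp_mul_tprod`): divide out the
zeros in a disc of radius R, take a logarithm of the quotient, and let Borel–Carathéodory and
Schwarz show that its nonlinear part tends to 0. A Jensen-type count gives ∑ |b_n|⁻² < ∞. Each
factor (1 - s/b)e^{s/b} has derivative 0 at 0, so the exponent is F'(0)/F(0) = -I(0) = -α, and the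
constant is F(0) = -1. -/

open Filter Topology Metric

/-! ### Dividing out and counting zeros -/

/-- Finitely many zeros of an entire function can be divided out. -/
theorem exists_eq_prod_mul_of_card_le_order {ι : Type*} [DecidableEq ι] {F : ℂ → ℂ}
    (hF : Differentiable ℂ F) (b : ι → ℂ) (S : Finset ι) (hb : ∀ i ∈ S, b i ≠ 0)
    (hS : ∀ z, ((S.filter (b · = z)).card : ℕ∞) ≤ analyticOrderAt F z) :
    ∃ g : ℂ → ℂ, Differentiable ℂ g ∧ (∀ z, F z = (∏ i ∈ S, (1 - z / b i)) * g z) ∧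
      ∀ z, analyticOrderAt F z = (S.filter (b · = z)).card + analyticOrderAt g z := by
  induction S using Finset.induction_on with
  | empty => exact ⟨F, hF, by simp, by simp⟩
  | insert j S hj ih =>
    have hsub : ∀ z, (S.filter (b · = z)) ⊆ ((insert j S).filter (b · = z)) := fun z =>
      Finset.filter_subset_filter _ (Finset.subset_insert _ _)
    obtain ⟨g, hg, hFg, hord⟩ := ih (fun i hi => hb i (Finset.mem_insert_of_mem hi))
      (fun z => le_trans (by exact_mod_cast Finset.card_le_card (hsub z)) (hS z))
    have hbj : b j ≠ 0 := hb j (Finset.mem_insert_self _ _)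
    -- F has at `b j` at least one zero more than `S` accounts for.
    have hgj : g (b j) = 0 := by
      have h1 := hS (b j)
      rw [hord, Finset.filter_insert, if_pos rfl, Finset.card_insert_of_notMem (by simp [hj])] at h1
      push_cast at h1
      have h2 := (ENat.add_le_add_iff_left (ENat.natCast_ne_top _)).mp h1
      refine apply_eq_zero_of_analyticOrderAt_ne_zero fun h0 => ?_
      rw [h0] at h2
      exact absurd h2 (by simp)
    have hd : Differentiable ℂ (dslope g (b j)) := by
      rw [← differentiableOn_univ] at hg ⊢
      exact (Complex.differentiableOn_dslope univ_mem).mpr hg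
    have hfac : ∀ z, g z = (1 - z / b j) * (-b j * dslope g (b j) z) := fun z => by
      have := sub_smul_dslope g (b j) z
      rw [hgj, sub_zero, smul_eq_mul] at this
      rw [← this]
      field_simp
      ring
    refine ⟨fun z => -b j * dslope g (b j) z, hd.const_mul _, fun z => ?_, fun z => ?_⟩
    · rw [hFg, Finset.prod_insert hj, hfac z]
      ring
    · rw [hord]
      have hlin : AnalyticAt ℂ (fun z => 1 - z / b j) z := by fun_prop
      have hd' : AnalyticAt ℂ (fun z => -b j * dslope g (b j) z) z := (hd.const_mul _).analyticAt z
      have hmul : analyticOrderAt g z = analyticOrderAt (fun z => 1 - z / b j) z +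
          analyticOrderAt (fun z => -b j * dslope g (b j) z) z := by
        rw [← analyticOrderAt_mul hlin hd']
        exact congrArg (analyticOrderAt · z) (funext hfac)
      rw [hmul, Finset.filter_insert]
      split_ifs with hz
      · subst hz
        rw [Finset.card_insert_of_notMem (by simp [hj]),
          hlin.analyticOrderAt_eq_one_of_zero_deriv_ne_zero (by simp [hbj])]
        · push_cast; ring
        · have : HasDerivAt (fun z => 1 - z / b j) (-(1 / b j)) (b j) := by
            simpa using ((hasDerivAt_id (b j)).div_const (b j)).const_sub 1
          rw [this.deriv]
          simpa using hbj
      · rw [(hlin.analyticOrderAt_eq_zero).mpr, zero_add]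
        intro h0
        rw [sub_eq_zero, eq_comm, div_eq_one_iff_eq hbj] at h0
        exact hz h0.symm

theorem norm_le_of_forall_sphere_norm_le {g : ℂ → ℂ} (hg : Differentiable ℂ g) {R C : ℝ}
    (hR : 0 < R) (h : ∀ z, ‖z‖ = R → ‖g z‖ ≤ C) {z : ℂ} (hz : ‖z‖ ≤ R) : ‖g z‖ ≤ C := by
  refine Complex.norm_le_of_forall_mem_frontier_norm_le (U := ball 0 R) isBounded_ball
    hg.diffContOnCl (fun w hw => h w ?_) ?_
  · rw [frontier_ball _ hR.ne'] at hw
    simpa using hw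
  · rw [closure_ball _ hR.ne']
    simpa using hz

/-- `b` lists the zeros of the entire function `F` with multiplicity. -/
structure ListsZeros {ι : Type*} (F : ℂ → ℂ) (b : ι → ℂ) : Prop where
  differentiable : Differentiable ℂ F
  map_zero : F 0 ≠ 0
  encard : ∀ z : ℂ, {i | b i = z}.encard = analyticOrderAt F z

namespace ListsZeros

variable {ι : Type*} {F : ℂ → ℂ} {b : ι → ℂ}

theorem order_ne_top (h : ListsZeros F b) (z : ℂ) : analyticOrderAt F z ≠ ⊤ :=
  AnalyticOnNhd.analyticOrderAt_ne_top_of_isPreconnected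
    (fun z _ => h.differentiable.analyticAt z) isPreconnected_univ (mem_univ 0) (mem_univ z)
    (by rw [((h.differentiable.analyticAt 0).analyticOrderAt_eq_zero).mpr h.map_zero]; simp)

theorem apply_eq_zero (h : ListsZeros F b) (i : ι) : F (b i) = 0 := by
  refine apply_eq_zero_of_analyticOrderAt_ne_zero ?_
  rw [← h.encard, Set.encard_ne_zero]
  exact ⟨i, rfl⟩

theorem ne_zero (h : ListsZeros F b) (i : ι) : b i ≠ 0 := fun h0 =>
  h.map_zero (h0 ▸ h.apply_eq_zero i)

theorem card_filter_le (h : ListsZeros F b) (S : Finset ι) (z : ℂ) :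
    ((S.filter (b · = z)).card : ℕ∞) ≤ analyticOrderAt F z := by
  rw [← h.encard, ← Set.encard_coe_eq_coe_finsetCard]
  exact Set.encard_le_encard fun i hi => by simpa using (Finset.mem_filter.mp hi).2

/-- When `S` contains every index of z, the factors use up the whole (finite) order of F at z, so
the quotient has order 0 there. -/
theorem exists_factor (h : ListsZeros F b) (S : Finset ι) :
    ∃ g : ℂ → ℂ, Differentiable ℂ g ∧ (∀ z, F z = (∏ i ∈ S, (1 - z / b i)) * g z) ∧
      ∀ z, (∀ i, b i = z → i ∈ S) → g z ≠ 0 := by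
  classical
  obtain ⟨g, hg, hFg, hord⟩ := exists_eq_prod_mul_of_card_le_order h.differentiable b S
    (fun i _ => h.ne_zero i) (h.card_filter_le S)
  refine ⟨g, hg, hFg, fun z hz => ?_⟩
  have h1 : {i | b i = z} = ↑(S.filter (b · = z)) := by
    ext i
    simpa using hz i
  have h2 := hord z
  rw [← h.encard, h1, Set.encard_coe_eq_coe_finsetCard] at h2
  rw [← (hg.analyticAt z).analyticOrderAt_eq_zero]
  by_contra h0
  exact (ENat.lt_add_left (ENat.natCast_ne_top _) (pos_iff_ne_zero.mpr h0) |>.ne') (by rw [add_comm]; exact h2.symm)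

/-- A form of Jensen's inequality for the number of zeros in a disc. -/
theorem norm_mul_two_pow_le (h : ListsZeros F b) {S : Finset ι} {R M : ℝ} (hR : 0 < R)
    (hS : ∀ i ∈ S, ‖b i‖ ≤ R) (hM : ∀ z, ‖z‖ = 3 * R → ‖F z‖ ≤ M) :
    ‖F 0‖ * 2 ^ S.card ≤ M := by
  obtain ⟨g, hg, hFg, -⟩ := h.exists_factor S
  have h0 : F 0 = g 0 := by simpa using hFg 0
  rw [h0, ← le_div_iff₀ (by positivity)]
  refine norm_le_of_forall_sphere_norm_le hg (R := 3 * R) (by positivity) (fun z hz => ?_)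
    (by simpa using hR.le)
  rw [le_div_iff₀ (by positivity)]
  refine le_trans ?_ (hM z hz)
  rw [hFg, norm_mul, norm_prod, mul_comm]
  refine mul_le_mul_of_nonneg_right ?_ (norm_nonneg _)
  rw [← Finset.prod_const]
  refine Finset.prod_le_prod (fun _ _ => by norm_num) fun i hi => ?_
  have hbi : 0 < ‖b i‖ := norm_pos_iff.mpr (h.ne_zero i)
  -- On the circle of radius 3R each removed factor has modulus at least 3 - 1 = 2.
  have h3 : 3 ≤ ‖z / b i‖ := by
    rw [norm_div, le_div_iff₀ hbi, hz]
    linarith [hS i hi]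
  have h4 := norm_sub_norm_le (z / b i) 1
  rw [norm_one, norm_sub_rev] at h4
  linarith

theorem finite_norm_le (h : ListsZeros F b) (R : ℝ) : {i | ‖b i‖ ≤ R}.Finite := by
  by_contra hinf
  obtain ⟨M, hM⟩ := (isCompact_sphere (0 : ℂ) (3 * max R 1)).exists_bound_of_continuousOn
    h.differentiable.continuous.continuousOn
  have hF0 : 0 < ‖F 0‖ := norm_pos_iff.mpr h.map_zero
  obtain ⟨n, hn⟩ := pow_unbounded_of_one_lt (M / ‖F 0‖) (one_lt_two)
  obtain ⟨S, hS, hcard⟩ := Set.Infinite.exists_subset_card_eq hinf n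
  have := h.norm_mul_two_pow_le (S := S) (R := max R 1) (M := M) (by positivity)
    (fun i hi => (hS hi).trans (le_max_left _ _)) (fun z hz => hM z (by simpa using hz))
  rw [div_lt_iff₀ hF0, ← hcard] at hn
  linarith

end ListsZeros

/-! ### Hadamard factorization in genus one -/

theorem exists_log_on_ball {g : ℂ → ℂ} (hg : Differentiable ℂ g) {R : ℝ}
    (h0 : ∀ z ∈ ball (0 : ℂ) R, g z ≠ 0) (hR : 0 < R) :
    ∃ h : ℂ → ℂ, h 0 = 0 ∧ DifferentiableOn ℂ h (ball 0 R) ∧ deriv h 0 = logDeriv g 0 ∧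
      ∀ z ∈ ball (0 : ℂ) R, g z = g 0 * Complex.exp (h z) := by
  have hd : DifferentiableOn ℂ (fun z => deriv g z / g z) (ball 0 R) := by
    refine DifferentiableOn.div (hg.contDiff.differentiable_deriv_two).differentiableOn
      hg.differentiableOn h0
  obtain ⟨h, hh0, hh⟩ := hd.isExactOn_ball.with_val_at 0 0
  have h00 : (0 : ℂ) ∈ ball (0 : ℂ) R := mem_ball_self hR
  refine ⟨h, hh0, fun z hz => (hh z hz).differentiableAt.differentiableWithinAt, ?_, fun z hz => ?_⟩
  · rw [(hh 0 h00).deriv, logDeriv_apply]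
  · have hder : ∀ w ∈ ball (0 : ℂ) R, HasDerivAt (fun w => g w * Complex.exp (-h w)) 0 w := by
      intro w hw
      have := (hg w).hasDerivAt.mul (hh w hw).neg.cexp
      refine this.congr_deriv ?_
      have := h0 w hw
      field_simp
      simp
    have := isOpen_ball.is_const_of_deriv_eq_zero (convex_ball (0 : ℂ) R).isPreconnected
      (fun w hw => (hder w hw).differentiableAt.differentiableWithinAt)
      (fun w hw => (hder w hw).deriv) hz h00
    simp only [hh0, neg_zero, Complex.exp_zero, mul_one] at this
    rw [← this, mul_assoc, ← Complex.exp_add]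
    simp

/-- If `Re h ≤ M` on the disc of radius `R` and `h 0 = 0`, then `h` is close to its linear part. -/
theorem norm_sub_deriv_mul_le {h : ℂ → ℂ} {R M : ℝ} (hR : 0 < R) (hM : 0 < M)
    (hd : DifferentiableOn ℂ h (ball 0 R)) (h0 : h 0 = 0)
    (hre : ∀ z ∈ ball (0 : ℂ) R, (h z).re ≤ M) {z : ℂ} (hz : ‖z‖ < R / 2) :
    ‖h z - deriv h 0 * z‖ ≤ 16 * M * ‖z‖ ^ 2 / R ^ 2 := by
  have hsub : ball (0 : ℂ) (R / 2) ⊆ ball 0 R := ball_subset_ball (by linarith)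
  have hb : ∀ w ∈ ball (0 : ℂ) (R / 2), ‖h w‖ ≤ 2 * M := fun w hw => by
    refine (Complex.borelCaratheodory_zero hM hd hre hR (hsub hw) h0).trans ?_
    have hw' : ‖w‖ < R / 2 := by simpa using hw
    rw [div_le_iff₀ (by linarith)]
    nlinarith
  have hd2 := hd.mono hsub
  have hder : ‖deriv h 0‖ ≤ 2 * M / (R / 2) :=
    Complex.norm_deriv_le_div_of_mapsTo_ball hd2
      (fun w hw => by simpa [h0] using hb w hw) (by positivity)
  have hat : DifferentiableAt ℂ h 0 := hd.differentiableAt (ball_mem_nhds _ hR)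
  -- Schwarz lemma for a function vanishing to second order at 0 and bounded by 4M on the disc of
  -- radius R/2: the bound is 4M(‖z‖/(R/2))².
  have key := Complex.dist_le_mul_div_pow_of_mapsTo_ball_of_isLittleO
    (f := fun w => h w - deriv h 0 * w) (c := 0) (z := z) (R₁ := R / 2) (R₂ := 4 * M) (n := 1)
    (hd2.sub (by fun_prop)) (fun w hw => ?_) ?_ (by simpa using hz)
  · simp only [dist_eq_norm, h0, mul_zero, sub_zero] at key
    refine key.trans (le_of_eq ?_)
    rw [div_pow, div_pow]
    field_simp
    ring
  · simp only [h0, mul_zero, sub_zero, mem_closedBall, dist_zero_right]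
    have hw' : ‖w‖ < R / 2 := by simpa using hw
    calc ‖h w - deriv h 0 * w‖ ≤ ‖h w‖ + ‖deriv h 0‖ * ‖w‖ := by
          rw [← norm_mul]; exact norm_sub_le _ _
      _ ≤ 2 * M + 2 * M / (R / 2) * (R / 2) := by
          gcongr
          exact hb w hw
      _ = 4 * M := by field_simp; ring
  · have := hat.hasDerivAt.isLittleO
    simpa [h0, mul_comm] using this.norm_right

/-- (1 - w)e^w - 1 = O(w²) for |w| ≤ 1, and |s/b_i| ≤ 1 for all but finitely many i. -/
theorem multipliable_genus_one_factor {ι : Type*} {b : ι → ℂ}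
    (hsum : Summable fun i => (‖b i‖ ^ 2)⁻¹) (s : ℂ) :
    Multipliable fun i => (1 - s / b i) * Complex.exp (s / b i) := by
  have hs2 : Summable fun i => ‖s / b i‖ ^ 2 := by
    refine (hsum.mul_left (‖s‖ ^ 2)).congr fun i => ?_
    rw [norm_div, div_pow, div_eq_mul_inv]
  have hbound : Summable fun i => ‖(1 - s / b i) * Complex.exp (s / b i) - 1‖ := by
    refine Summable.of_norm_bounded_eventually (hs2.mul_left 3) ?_
    filter_upwards [hs2.tendsto_cofinite_zero.eventually_le_const one_pos] with i hi
    have hw : ‖s / b i‖ ≤ 1 := by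
      by_contra! hgt
      nlinarith
    set w := s / b i
    rw [norm_norm]
    calc ‖(1 - w) * Complex.exp w - 1‖
        = ‖(1 - w) * (Complex.exp w - 1 - w) - w ^ 2‖ := by congr 1; ring
      _ ≤ (1 + ‖w‖) * ‖w‖ ^ 2 + ‖w‖ ^ 2 := by
          refine (norm_sub_le _ _).trans ?_
          rw [norm_mul, norm_pow]
          gcongr
          · exact (norm_sub_le _ _).trans (by simp)
          · exact Complex.norm_exp_sub_one_sub_id_le hw
      _ ≤ 3 * ‖w‖ ^ 2 := by nlinarith [sq_nonneg ‖w‖]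
  simpa using multipliable_one_add_of_summable hbound

namespace ListsZeros

variable {ι : Type*} {F : ℂ → ℂ} {b : ι → ℂ}

/-- On |z| = 2R every factor 1 - z/b_i with |b_i| ≤ R has modulus at least 1, so the quotient
inherits the bound on F and, by the maximum principle, keeps it inside. It is zero-free on the disc
of radius R; E is the nonlinear part of its logarithm. -/
theorem exists_eq_mul_exp (h : ListsZeros F b) {S : Finset ι} {R M : ℝ} (hR : 0 < R) (hM : 0 < M)
    (hS : ∀ i, i ∈ S ↔ ‖b i‖ ≤ R) (hF : ∀ z, ‖z‖ = 2 * R → ‖F z‖ ≤ ‖F 0‖ * Real.exp M)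
    {z : ℂ} (hz : ‖z‖ < R / 2) :
    ∃ E : ℂ, ‖E‖ ≤ 16 * M * ‖z‖ ^ 2 / R ^ 2 ∧
      F z = F 0 * Complex.exp (logDeriv F 0 * z) *
        (∏ i ∈ S, (1 - z / b i) * Complex.exp (z / b i)) * Complex.exp E := by
  obtain ⟨g, hg, hFg, hne⟩ := h.exists_factor S
  have hF0 : 0 < ‖F 0‖ := norm_pos_iff.mpr h.map_zero
  have h0 : g 0 = F 0 := by simpa using (hFg 0).symm
  have hgne : ∀ w ∈ ball (0 : ℂ) R, g w ≠ 0 := fun w hw => hne w fun i hi =>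
    (hS i).mpr (by rw [hi]; simpa using (mem_ball.mp hw).le)
  have hgle : ∀ w ∈ ball (0 : ℂ) R, ‖g w‖ ≤ ‖F 0‖ * Real.exp M := fun w hw => by
    refine norm_le_of_forall_sphere_norm_le hg (R := 2 * R) (by positivity) (fun u hu => ?_)
      (by have : ‖w‖ < R := by simpa using hw
          linarith)
    refine le_trans ?_ (hF u hu)
    rw [hFg, norm_mul]
    refine le_mul_of_one_le_left (norm_nonneg _) ?_
    rw [norm_prod]
    rw [← Finset.prod_const_one (s := S)]
    refine Finset.prod_le_prod (fun _ _ => zero_le_one) fun i hi => ?_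
    have hbi : 0 < ‖b i‖ := norm_pos_iff.mpr (h.ne_zero i)
    have h3 : 2 ≤ ‖u / b i‖ := by
      rw [norm_div, le_div_iff₀ hbi, hu]
      linarith [(hS i).mp hi]
    have h4 := norm_sub_norm_le (u / b i) 1
    rw [norm_one, norm_sub_rev] at h4
    linarith
  obtain ⟨k, hk0, hkd, hkder, hk⟩ := exists_log_on_ball hg hgne hR
  refine ⟨k z - deriv k 0 * z, norm_sub_deriv_mul_le hR hM hkd hk0 (fun w hw => ?_) hz, ?_⟩
  · have := hgle w hw
    rw [hk w hw, norm_mul, h0, Complex.norm_exp] at this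
    exact Real.exp_le_exp.mp (le_of_mul_le_mul_left this hF0)
  -- The linear term of `k` thus supplies both the factor with `logDeriv F 0` and the convergence
  -- factors e^{z/b_i}.
  · have hlog : logDeriv F 0 = -(∑ i ∈ S, 1 / b i) + deriv k 0 := by
      rw [hkder, show F = fun w => (∏ i ∈ S, (1 - w / b i)) * g w from funext hFg,
        logDeriv_mul 0 (by simp) (by rw [h0]; exact h.map_zero) (by fun_prop) (hg 0),
        logDeriv_prod (by simp) (by intros; fun_prop), ← Finset.sum_neg_distrib]
      congr 1
      refine Finset.sum_congr rfl fun i _ => ?_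
      have : HasDerivAt (fun z => 1 - z / b i) (-(1 / b i)) 0 := by
        simpa using ((hasDerivAt_id (0 : ℂ)).div_const (b i)).const_sub 1
      rw [logDeriv_apply, this.deriv]
      simp
    rw [hFg z, hk z (by simp; linarith), h0, Finset.prod_mul_distrib, ← Complex.exp_sum, hlog]
    have : Complex.exp (k z) = Complex.exp ((-(∑ i ∈ S, 1 / b i) + deriv k 0) * z) *
        Complex.exp (∑ i ∈ S, z / b i) * Complex.exp (k z - deriv k 0 * z) := by
      rw [← Complex.exp_add, ← Complex.exp_add]
      congr 1
      simp only [div_eq_mul_inv, ← Finset.mul_sum, one_mul]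
      ring
    rw [this]
    ring

/-- Hadamard's factorization in genus one, along the zeros in growing discs. -/
theorem tendsto_prod (h : ListsZeros F b) {ρ : ℝ} (hρ : ρ < 2)
    (hgrow : ∀ᶠ z in Bornology.cobounded ℂ, ‖F z‖ ≤ Real.exp (‖z‖ ^ ρ)) (z : ℂ) :
    Tendsto (fun n : ℕ => ∏ i ∈ (h.finite_norm_le n).toFinset,
      (1 - z / b i) * Complex.exp (z / b i)) atTop
      (𝓝 (F z / (F 0 * Complex.exp (logDeriv F 0 * z)))) := by
  have hF0 : 0 < ‖F 0‖ := norm_pos_iff.mpr h.map_zero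
  -- `c` absorbs the normalization by ‖F 0‖ and keeps `M` positive; 2n is the radius of the circle
  -- where F is bounded.
  set c : ℝ := |Real.log ‖F 0‖| + 1 with hc
  set M : ℕ → ℝ := fun n => (2 * n : ℝ) ^ ρ + c with hMdef
  have hMpos : ∀ n, 0 < M n := fun n => by positivity
  obtain ⟨r, hr⟩ : ∃ r : ℝ, ∀ z : ℂ, r ≤ ‖z‖ → ‖F z‖ ≤ Real.exp (‖z‖ ^ ρ) := by
    rw [← comap_norm_atTop, eventually_comap] at hgrow
    obtain ⟨r, hr⟩ := eventually_atTop.mp hgrow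
    exact ⟨r, fun z hz => hr _ hz z rfl⟩
  have hev : ∀ᶠ n : ℕ in atTop, ∃ E : ℂ, ‖E‖ ≤ 16 * M n * ‖z‖ ^ 2 / (n : ℝ) ^ 2 ∧
      F z = F 0 * Complex.exp (logDeriv F 0 * z) *
        (∏ i ∈ (h.finite_norm_le n).toFinset, (1 - z / b i) * Complex.exp (z / b i)) *
          Complex.exp E := by
    filter_upwards [tendsto_natCast_atTop_atTop.eventually_gt_atTop (max r (2 * ‖z‖))] with n hn
    have hn1 : r < n := (le_max_left _ _).trans_lt hn
    have hn2 : 2 * ‖z‖ < n := (le_max_right _ _).trans_lt hn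
    have hn0 : (0 : ℝ) < n := lt_of_le_of_lt (by positivity) hn2
    refine h.exists_eq_mul_exp hn0 (hMpos n) (by simp) (fun w hw => ?_) (by linarith)
    refine (hr w (by linarith)).trans ?_
    rw [hw]
    rw [show ‖F 0‖ * Real.exp (M n) = Real.exp (Real.log ‖F 0‖ + M n) by
      rw [Real.exp_add (Real.log ‖F 0‖), Real.exp_log hF0]]
    refine Real.exp_le_exp.mpr ?_
    simp only [hMdef, hc]
    linarith [neg_abs_le (Real.log ‖F 0‖)]
  obtain ⟨N, hN⟩ := eventually_atTop.mp hev
  choose! E hE1 hE2 using hN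
  have hev' : ∀ᶠ n : ℕ in atTop, ‖E n‖ ≤ 16 * M n * ‖z‖ ^ 2 / (n : ℝ) ^ 2 :=
    eventually_atTop.mpr ⟨N, hE1⟩
  have hM0 : Tendsto (fun n : ℕ => 16 * M n * ‖z‖ ^ 2 / (n : ℝ) ^ 2) atTop (𝓝 0) := by
    have h1 : Tendsto (fun n : ℕ => (n : ℝ) ^ (-(2 - ρ))) atTop (𝓝 0) :=
      (tendsto_rpow_neg_atTop (by linarith)).comp tendsto_natCast_atTop_atTop
    have h2 : Tendsto (fun n : ℕ => (n : ℝ) ^ (-2 : ℝ)) atTop (𝓝 0) :=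
      (tendsto_rpow_neg_atTop (by norm_num)).comp tendsto_natCast_atTop_atTop
    have h3 := (((h1.const_mul (2 ^ ρ)).add (h2.const_mul c)).const_mul (16 * ‖z‖ ^ 2))
    simp only [mul_zero, add_zero] at h3
    refine h3.congr' ?_
    filter_upwards [eventually_gt_atTop 0] with n hn
    have hn' : (0 : ℝ) < n := by exact_mod_cast hn
    simp only [hMdef]
    rw [neg_sub, Real.rpow_sub hn', Real.mul_rpow (by norm_num) hn'.le, Real.rpow_neg hn'.le,
      Real.rpow_two]
    field_simp
  have hE0 : Tendsto E atTop (𝓝 0) := squeeze_zero_norm' hev' hM0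
  have hexp : Tendsto (fun n => F z / (F 0 * Complex.exp (logDeriv F 0 * z)) *
      Complex.exp (-E n)) atTop (𝓝 (F z / (F 0 * Complex.exp (logDeriv F 0 * z)))) := by
    have := (Complex.continuous_exp.tendsto _).comp hE0.neg
    simpa using this.const_mul (F z / (F 0 * Complex.exp (logDeriv F 0 * z)))
  refine hexp.congr' (eventually_atTop.mpr ⟨N, fun n hn => ?_⟩)
  have h5 := hE2 n hn
  have h6 := h.map_zero
  have h7 := Complex.exp_ne_zero (logDeriv F 0 * z)
  rw [Complex.exp_neg]
  field_simp [Complex.exp_ne_zero]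
  rw [h5]
  ring

/-- **Hadamard's factorization theorem** in genus one. -/
theorem eq_exp_mul_tprod (h : ListsZeros F b) {ρ : ℝ} (hρ : ρ < 2)
    (hgrow : ∀ᶠ z in Bornology.cobounded ℂ, ‖F z‖ ≤ Real.exp (‖z‖ ^ ρ))
    (hsum : Summable fun i => (‖b i‖ ^ 2)⁻¹) (s : ℂ) :
    F s = F 0 * Complex.exp (logDeriv F 0 * s) *
      ∏' i, (1 - s / b i) * Complex.exp (s / b i) := by
  have hT : Tendsto (fun n : ℕ => (h.finite_norm_le n).toFinset) atTop atTop := by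
    refine tendsto_atTop_finset_of_monotone (fun m n hmn i hi => ?_) fun i => ?_
    · simp only [Finite.mem_toFinset, mem_ofPred_eq] at hi ⊢
      exact hi.trans (by exact_mod_cast hmn)
    · obtain ⟨n, hn⟩ := exists_nat_ge ‖b i‖
      exact ⟨n, by simpa using hn⟩
  -- The product converges unconditionally, so its value can be read off along growing discs.
  have h1 := ((multipliable_genus_one_factor hsum s).hasProd).comp hT
  have h2 := tendsto_nhds_unique h1 (h.tendsto_prod hρ hgrow s)
  rw [h2, mul_div_cancel₀]
  exact mul_ne_zero h.map_zero (Complex.exp_ne_zero _)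

end ListsZeros

/-! ### The theta series -/

/-- The sum `∑_{n ≥ 1} exp(-π n² x)` as a real number. -/
noncomputable def psiReal (x : ℝ) : ℝ := ∑' n : ℕ, Real.exp (-Real.pi * ((n : ℝ) + 1) ^ 2 * x)

theorem thetaFn_eq_jacobiTheta (z : ℂ) : thetaFn z = jacobiTheta (Complex.I * z) := by
  unfold thetaFn jacobiTheta
  congr 1
  ext n
  congr 1
  linear_combination (-(Real.pi : ℂ) * (n : ℂ) ^ 2 * z) * Complex.I_mul_I

theorem psiFn_ofReal {x : ℝ} (hx : 0 < x) : psiFn x = psiReal x := by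
  have h := hasSum_nat_jacobiTheta (τ := Complex.I * x) (by simpa using hx)
  rw [psiFn, thetaFn_eq_jacobiTheta, ← h.tsum_eq, psiReal, Complex.ofReal_tsum]
  congr 1
  ext n
  push_cast
  congr 1
  linear_combination ((Real.pi : ℂ) * ((n : ℂ) + 1) ^ 2 * x) * Complex.I_mul_I

theorem continuousOn_psiFn : ContinuousOn (fun x : ℝ => psiFn x) (Ioi 0) := by
  intro x hx
  have h : ContinuousAt jacobiTheta (Complex.I * x) :=
    (differentiableAt_jacobiTheta (by simpa using hx)).continuousAt
  have h2 : ContinuousAt (fun y : ℝ => jacobiTheta (Complex.I * y)) x :=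
    ContinuousAt.comp (f := fun y : ℝ => Complex.I * y) h (by fun_prop)
  simp only [psiFn, thetaFn_eq_jacobiTheta]
  exact ((h2.sub continuousAt_const).div_const 2).continuousWithinAt

theorem exp_neg_three_pi_lt : Real.exp (-(3 * Real.pi)) < 1 / 10000 := by
  have h1 : Real.exp (-(3 * Real.pi)) ≤ Real.exp (-1) ^ 9 * Real.exp (-0.42) := by
    rw [← Real.exp_nat_mul, ← Real.exp_add]
    refine Real.exp_le_exp.mpr ?_
    have := Real.pi_gt_d2
    push_cast
    linarith
  have h2 : Real.exp (-1) < 0.367880 := by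
    have := Real.exp_neg_one_lt_d9
    linarith
  have h3 : Real.exp (-0.42) ≤ 0.71 := by
    have h4 : (1 + 0.21 : ℝ) ≤ Real.exp 0.21 := by
      have := Real.add_one_le_exp (0.21 : ℝ)
      linarith
    have h5 : Real.exp 0.42 = Real.exp 0.21 ^ 2 := by
      rw [← Real.exp_nat_mul]; norm_num
    rw [Real.exp_neg, inv_le_comm₀ (Real.exp_pos _) (by norm_num), h5]
    calc ((0.71 : ℝ))⁻¹ ≤ (1 + 0.21) ^ 2 := by norm_num
      _ ≤ _ := by gcongr
  calc _ ≤ _ := h1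
    _ ≤ 0.367880 ^ 9 * 0.71 := by gcongr
    _ < _ := by norm_num

/-- (n + 1)² - 1 = n² + 2n ≥ 3n, which gives a geometric majorant of ratio e^{-3π} < 10⁻⁴. -/
theorem psiReal_term_le {x : ℝ} (hx : 1 ≤ x) (n : ℕ) :
    Real.exp (-Real.pi * ((n : ℝ) + 1) ^ 2 * x) ≤
      Real.exp (-Real.pi * x) * Real.exp (-(3 * Real.pi)) ^ n := by
  rw [← Real.exp_nat_mul, ← Real.exp_add]
  refine Real.exp_le_exp.mpr ?_
  have h1 : (n : ℝ) ≤ (n : ℝ) ^ 2 := by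
    rcases Nat.eq_zero_or_pos n with rfl | h
    · simp
    · have : (1 : ℝ) ≤ n := by exact_mod_cast h
      nlinarith
  have h2 : 3 * (n : ℝ) ≤ ((n : ℝ) ^ 2 + 2 * n) * x := by nlinarith
  nlinarith [mul_le_mul_of_nonneg_left h2 Real.pi_pos.le]

theorem summable_psiReal {x : ℝ} (hx : 1 ≤ x) :
    Summable fun n : ℕ => Real.exp (-Real.pi * ((n : ℝ) + 1) ^ 2 * x) := by
  refine Summable.of_nonneg_of_le (fun _ => (Real.exp_pos _).le) (psiReal_term_le hx) ?_
  refine (summable_geometric_of_lt_one (Real.exp_pos _).le ?_).mul_left _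
  linarith [exp_neg_three_pi_lt]

theorem exp_le_psiReal {x : ℝ} (hx : 1 ≤ x) : Real.exp (-Real.pi * x) ≤ psiReal x := by
  simpa [psiReal] using (summable_psiReal hx).le_tsum 0 (fun _ _ => (Real.exp_pos _).le)

theorem psiReal_le {x : ℝ} (hx : 1 ≤ x) :
    psiReal x ≤ 10000 / 9999 * Real.exp (-Real.pi * x) := by
  have hq := exp_neg_three_pi_lt
  have h1 : HasSum (fun n : ℕ => Real.exp (-Real.pi * x) * Real.exp (-(3 * Real.pi)) ^ n)
      (Real.exp (-Real.pi * x) * (1 - Real.exp (-(3 * Real.pi)))⁻¹) :=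
    (hasSum_geometric_of_lt_one (Real.exp_pos _).le (by linarith)).mul_left _
  refine (hasSum_le (psiReal_term_le hx) (summable_psiReal hx).hasSum h1).trans ?_
  rw [mul_comm]
  gcongr
  rw [inv_le_comm₀ (by linarith) (by norm_num)]
  linarith

/-! ### The incomplete Gamma integral -/

/-- `∫_1^∞ x^{a-1} e^{-πx} dx`. -/
noncomputable def incGamma (a : ℝ) : ℝ := ∫ x in Ioi (1 : ℝ), x ^ (a - 1) * Real.exp (-Real.pi * x)

theorem integrableOn_rpow_mul_exp (c : ℝ) {l r : ℝ} (hl : 0 < l) (hr : 0 < r) :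
    IntegrableOn (fun x : ℝ => x ^ c * Real.exp (-r * x)) (Ioi l) := by
  refine integrable_of_isBigO_exp_neg (b := r / 2) (by positivity) ?_ ?_
  · refine ContinuousOn.mul (fun x hx => ?_) (by fun_prop)
    exact (Real.continuousAt_rpow_const _ _ (Or.inl (hl.trans_le hx).ne')).continuousWithinAt
  · have h := (isLittleO_rpow_exp_pos_mul_atTop c (b := r / 2) (by positivity)).isBigO.mul
      (Asymptotics.isBigO_refl (fun x : ℝ => Real.exp (-r * x)) atTop)
    refine h.congr_right fun x => ?_
    rw [← Real.exp_add]
    congr 1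
    ring

theorem integrableOn_incGamma (c : ℝ) :
    IntegrableOn (fun x : ℝ => x ^ c * Real.exp (-Real.pi * x)) (Ioi 1) :=
  integrableOn_rpow_mul_exp c one_pos Real.pi_pos

theorem incGamma_nonneg (a : ℝ) : 0 ≤ incGamma a :=
  setIntegral_nonneg measurableSet_Ioi fun x hx => by
    have : (0 : ℝ) < x := one_pos.trans hx
    positivity

/-- Integration by parts. It holds for every real a, so the numerical recursion may start at
negative arguments. -/
theorem pi_mul_incGamma (a : ℝ) :
    Real.pi * incGamma a = Real.exp (-Real.pi) + (a - 1) * incGamma (a - 1) := by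
  have hder : ∀ x ∈ Ici (1 : ℝ), HasDerivAt (fun x : ℝ => -(x ^ (a - 1) * Real.exp (-Real.pi * x)))
      (Real.pi * (x ^ (a - 1) * Real.exp (-Real.pi * x)) -
        (a - 1) * (x ^ (a - 1 - 1) * Real.exp (-Real.pi * x))) x := by
    intro x hx
    have hx0 : (0 : ℝ) < x := one_pos.trans_le hx
    have h1 := Real.hasDerivAt_rpow_const (x := x) (p := a - 1) (Or.inl hx0.ne')
    have h2 : HasDerivAt (fun x : ℝ => Real.exp (-Real.pi * x))
        (Real.exp (-Real.pi * x) * (-Real.pi)) x := by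
      simpa using ((hasDerivAt_id x).const_mul (-Real.pi)).exp
    refine (h1.mul h2).neg.congr_deriv ?_
    ring
  have hi1 := (integrableOn_incGamma (a - 1)).const_mul Real.pi
  have hi2 := (integrableOn_incGamma (a - 1 - 1)).const_mul (a - 1)
  have := MeasureTheory.integral_Ioi_of_hasDerivAt_of_tendsto' hder (hi1.sub hi2)
    (by simpa using (tendsto_rpow_mul_exp_neg_mul_atTop_nhds_zero (a - 1) Real.pi Real.pi_pos).neg)
  rw [integral_sub hi1 hi2, integral_const_mul, integral_const_mul] at this
  simp only [Real.one_rpow, mul_one, one_mul] at this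
  simp only [incGamma]
  linarith

/-- x ≤ a e^{x/a} gives x^a ≤ a^a e^x, and e^{-πx} absorbs e^x with room to spare. -/
theorem incGamma_le_rpow_self {a : ℝ} (ha : 0 < a) : incGamma a ≤ a ^ a := by
  have hpi := Real.pi_gt_three
  have h1 : IntegrableOn (fun x : ℝ => a ^ a * Real.exp (-x)) (Ioi 1) := by
    have := (integrableOn_exp_mul_Ioi (a := -1) (by norm_num) 1).const_mul (a ^ a)
    simpa [IntegrableOn] using this
  have h2 : incGamma a ≤ ∫ x in Ioi (1 : ℝ), a ^ a * Real.exp (-x) := by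
    refine setIntegral_mono_on (integrableOn_incGamma _) h1 measurableSet_Ioi fun x hx => ?_
    have hx1 : 1 < x := hx
    have hx0 : 0 < x := one_pos.trans hx1
    calc x ^ (a - 1) * Real.exp (-Real.pi * x) ≤ x ^ a * Real.exp (-(2 * x)) := by
          gcongr
          · exact hx1.le
          · linarith
          · nlinarith
      _ = a ^ a * (x / a) ^ a * Real.exp (-(2 * x)) := by
          rw [← Real.mul_rpow ha.le (by positivity), mul_div_cancel₀ _ ha.ne']
      _ ≤ a ^ a * Real.exp (x / a) ^ a * Real.exp (-(2 * x)) := by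
          gcongr
          linarith [Real.add_one_le_exp (x / a)]
      _ = a ^ a * Real.exp (-x) := by
          rw [← Real.exp_mul, div_mul_cancel₀ _ ha.ne', mul_assoc, ← Real.exp_add]
          congr 2
          ring
  rw [integral_const_mul, integral_exp_neg_Ioi] at h2
  refine h2.trans (mul_le_of_le_one_right (by positivity) ?_)
  rw [Real.exp_le_one_iff]
  norm_num

/-- On x > K² one has x^{r/2} ≥ K^r. As K is arbitrary, the integral outgrows every exponential in
r. -/
theorem exists_mul_rpow_le_incGamma {K : ℝ} (hK : 1 ≤ K) :
    ∃ c : ℝ, 0 < c ∧ ∀ r : ℝ, 0 ≤ r → c * K ^ r ≤ incGamma (r / 2) := by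
  have hpi := Real.pi_pos
  refine ⟨Real.exp (-(Real.pi + 1) * K ^ 2) / (Real.pi + 1), by positivity, fun r hr => ?_⟩
  have hsub : Ioi (K ^ 2) ⊆ Ioi 1 := Ioi_subset_Ioi (one_le_pow₀ hK)
  have hK2 : 0 < K ^ 2 := by positivity
  have h1 : (∫ x in Ioi (K ^ 2), x ^ (r / 2 - 1) * Real.exp (-Real.pi * x)) ≤ incGamma (r / 2) := by
    refine setIntegral_mono_set (integrableOn_incGamma _) ?_ hsub.eventuallyLE
    refine (ae_restrict_mem measurableSet_Ioi).mono fun x hx => ?_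
    have : (0 : ℝ) < x := one_pos.trans hx
    simp only [Pi.zero_apply]
    positivity
  refine le_trans ?_ h1
  have hint := integrableOn_exp_mul_Ioi (a := -(Real.pi + 1)) (by linarith) (K ^ 2)
  have h2 : (∫ x in Ioi (K ^ 2), K ^ r * Real.exp (-(Real.pi + 1) * x)) ≤
      ∫ x in Ioi (K ^ 2), x ^ (r / 2 - 1) * Real.exp (-Real.pi * x) := by
    refine setIntegral_mono_on (hint.const_mul _) ((integrableOn_incGamma _).mono_set hsub)
      measurableSet_Ioi fun x hx => ?_
    have hx' : K ^ 2 < x := hx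
    have hx0 : 0 < x := hK2.trans hx'
    have h3 : K ^ r ≤ x ^ (r / 2) := by
      calc K ^ r = (K ^ 2) ^ (r / 2) := by
            rw [← Real.rpow_natCast, ← Real.rpow_mul (by linarith)]
            congr 1
            push_cast
            ring
        _ ≤ _ := by gcongr
    have h4 : Real.exp (-(Real.pi + 1) * x) ≤ x⁻¹ * Real.exp (-Real.pi * x) := by
      rw [show -(Real.pi + 1) * x = -x + -Real.pi * x by ring, Real.exp_add, Real.exp_neg]
      gcongr
      linarith [Real.add_one_le_exp x]
    rw [Real.rpow_sub hx0, Real.rpow_one, div_eq_mul_inv, mul_assoc]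
    gcongr
  refine le_trans (le_of_eq ?_) h2
  rw [integral_const_mul, integral_exp_mul_Ioi (by linarith)]
  field_simp

/-! ### The integral as an entire Mellin transform -/

/-- `ψ` cut off at `1`. -/
noncomputable def psiCut : ℝ → ℂ := (Ioi 1).indicator fun x => psiFn x

theorem norm_psiFn_le {x : ℝ} (hx : 1 ≤ x) : ‖psiFn x‖ ≤ 2 * Real.exp (-Real.pi * x) := by
  have h0 : 0 ≤ psiReal x := (Real.exp_pos _).le.trans (exp_le_psiReal hx)
  rw [psiFn_ofReal (one_pos.trans_le hx), Complex.norm_real, Real.norm_of_nonneg h0]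
  refine (psiReal_le hx).trans ?_
  gcongr
  norm_num

theorem norm_psiCut_le (x : ℝ) : ‖psiCut x‖ ≤ 2 * Real.exp (-Real.pi * x) := by
  by_cases hx : x ∈ Ioi 1
  · rw [psiCut, indicator_of_mem hx]
    exact norm_psiFn_le (le_of_lt hx)
  · rw [psiCut, indicator_of_notMem hx, norm_zero]
    positivity

theorem aestronglyMeasurable_psiCut : AEStronglyMeasurable psiCut := by
  rw [psiCut, aestronglyMeasurable_indicator_iff measurableSet_Ioi]
  exact (continuousOn_psiFn.mono (Ioi_subset_Ioi zero_le_one)).aestronglyMeasurable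
    measurableSet_Ioi

theorem locallyIntegrableOn_psiCut : LocallyIntegrableOn psiCut (Ioi 0) := by
  have : IntegrableOn psiCut (Ioi 0) := by
    refine Integrable.mono' (g := fun x => 2 * Real.exp (-Real.pi * x))
      ((integrableOn_exp_mul_Ioi (by linarith [Real.pi_pos]) 0).const_mul 2)
      aestronglyMeasurable_psiCut.restrict (ae_of_all _ norm_psiCut_le)
  exact this.locallyIntegrableOn

theorem psiCut_isBigO_atTop : psiCut =O[atTop] fun t => Real.exp (-Real.pi * t) :=
  Asymptotics.IsBigO.of_bound 2 (Eventually.of_forall fun x => by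
    simpa using norm_psiCut_le x)

theorem psiCut_isBigO_zero (b : ℝ) : psiCut =O[𝓝[>] 0] (· ^ (-b)) := by
  have : psiCut =ᶠ[𝓝[>] 0] fun _ => 0 := by
    filter_upwards [mem_nhdsWithin_of_mem_nhds (Iio_mem_nhds one_pos)] with x hx
    exact indicator_of_notMem (by simpa using (le_of_lt hx)) _
  exact this.trans_isBigO (Asymptotics.isBigO_zero _ _)

/-- `∫_1^∞ x^{s/2} ψ(x) dx/x`. -/
noncomputable def lavrikIntegral (s : ℂ) : ℂ := mellin psiCut (s / 2)

/-- The cut-off function vanishes near 0 and decays exponentially at ∞, so its Mellin transform has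
no boundary to its strip. -/
theorem differentiable_lavrikIntegral : Differentiable ℂ lavrikIntegral := fun s =>
  (mellin_differentiableAt_of_isBigO_rpow_exp (b := (s / 2).re - 1) Real.pi_pos
    locallyIntegrableOn_psiCut psiCut_isBigO_atTop (psiCut_isBigO_zero _) (by linarith)).comp s
    (by fun_prop)

theorem integrand_eq_indicator (s : ℂ) :
    (fun t : ℝ => (t : ℂ) ^ (s / 2 - 1) • psiCut t) =
      (Ioi 1).indicator fun x : ℝ => (x : ℂ) ^ (s / 2) * psiFn x / x := by
  ext x
  by_cases hx : x ∈ Ioi 1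
  · have hx0 : (x : ℂ) ≠ 0 := by exact_mod_cast (one_pos.trans hx).ne'
    rw [indicator_of_mem hx, psiCut, indicator_of_mem hx, Complex.cpow_sub _ _ hx0,
      Complex.cpow_one, smul_eq_mul]
    ring
  · rw [indicator_of_notMem hx, psiCut, indicator_of_notMem hx, smul_zero]

theorem inter_Ioi_one : Ioi (0 : ℝ) ∩ Ioi 1 = Ioi 1 := by
  rw [Ioi_inter_Ioi]
  simp

theorem integrableOn_lavrikIntegral (s : ℂ) :
    IntegrableOn (fun x : ℝ => (x : ℂ) ^ (s / 2) * psiFn x / x) (Ioi 1) := by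
  have h := mellinConvergent_of_isBigO_rpow_exp (b := (s / 2).re - 1) (s := s / 2) Real.pi_pos
    locallyIntegrableOn_psiCut psiCut_isBigO_atTop (psiCut_isBigO_zero _) (by linarith)
  rw [MellinConvergent, integrand_eq_indicator] at h
  rw [IntegrableOn, integrable_indicator_iff measurableSet_Ioi, IntegrableOn,
    Measure.restrict_restrict measurableSet_Ioi, inter_comm, inter_Ioi_one] at h
  exact h

theorem lavrikIntegral_eq (s : ℂ) :
    lavrikIntegral s = ∫ x in Ioi (1 : ℝ), (x : ℂ) ^ (s / 2) * psiFn x / x := by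
  rw [lavrikIntegral, mellin, integrand_eq_indicator, setIntegral_indicator measurableSet_Ioi,
    inter_Ioi_one]

theorem lavrikIntegral_zero : lavrikIntegral 0 = lavrikAlpha := by
  simp [lavrikIntegral_eq, lavrikAlpha]

theorem lavrikIntegral_conj (s : ℂ) :
    lavrikIntegral (starRingEnd ℂ s) = starRingEnd ℂ (lavrikIntegral s) := by
  rw [lavrikIntegral_eq, lavrikIntegral_eq, ← integral_conj]
  refine setIntegral_congr_fun measurableSet_Ioi fun x hx => ?_
  have hx0 : (0 : ℝ) < x := one_pos.trans hx
  have h1 : (x : ℂ) ^ (starRingEnd ℂ s / 2) = starRingEnd ℂ ((x : ℂ) ^ (s / 2)) := by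
    have := Complex.cpow_conj x (s / 2)
      (by rw [Complex.arg_ofReal_of_nonneg hx0.le]; exact Real.pi_pos.ne)
    simpa [Complex.conj_ofNat] using this
  simp only [h1, psiFn_ofReal hx0, map_div₀, map_mul, Complex.conj_ofReal]

theorem ofReal_cpow_mul_psiFn_div {x : ℝ} (hx : 1 < x) (r : ℝ) :
    (x : ℂ) ^ ((r : ℂ) / 2) * psiFn x / x = ((x ^ (r / 2 - 1) * psiReal x : ℝ) : ℂ) := by
  have hx0 : (0 : ℝ) < x := one_pos.trans hx
  rw [psiFn_ofReal hx0, Real.rpow_sub hx0, Real.rpow_one]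
  push_cast
  rw [Complex.ofReal_cpow hx0.le]
  push_cast
  ring

theorem integrableOn_rpow_mul_psiReal (r : ℝ) :
    IntegrableOn (fun x : ℝ => x ^ (r / 2 - 1) * psiReal x) (Ioi 1) := by
  have h := (integrableOn_lavrikIntegral r).re
  refine IntegrableOn.congr_fun h (fun x hx => ?_) measurableSet_Ioi
  simp only [ofReal_cpow_mul_psiFn_div hx]
  simp

theorem lavrikIntegral_ofReal (r : ℝ) :
    lavrikIntegral r = ((∫ x in Ioi (1 : ℝ), x ^ (r / 2 - 1) * psiReal x : ℝ) : ℂ) := by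
  rw [lavrikIntegral_eq, ← integral_complex_ofReal]
  exact setIntegral_congr_fun measurableSet_Ioi fun x hx => ofReal_cpow_mul_psiFn_div hx r

theorem incGamma_le_lavrikIntegral (r : ℝ) : incGamma (r / 2) ≤ (lavrikIntegral r).re := by
  rw [lavrikIntegral_ofReal, Complex.ofReal_re]
  refine setIntegral_mono_on (integrableOn_incGamma _) (integrableOn_rpow_mul_psiReal r)
    measurableSet_Ioi fun x hx => ?_
  have hx0 : (0 : ℝ) < x := one_pos.trans hx
  have := exp_le_psiReal (le_of_lt hx)
  gcongr

theorem lavrikIntegral_le_incGamma (r : ℝ) :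
    (lavrikIntegral r).re ≤ 10000 / 9999 * incGamma (r / 2) := by
  rw [lavrikIntegral_ofReal, Complex.ofReal_re, incGamma, ← integral_const_mul]
  refine setIntegral_mono_on (integrableOn_rpow_mul_psiReal r)
    ((integrableOn_incGamma _).const_mul _) measurableSet_Ioi fun x hx => ?_
  have hx0 : (0 : ℝ) < x := one_pos.trans hx
  have := psiReal_le (le_of_lt hx)
  rw [mul_left_comm]
  gcongr

theorem lavrikIntegral_mono : Monotone fun r : ℝ => (lavrikIntegral r).re := by
  intro r r' h
  simp only [lavrikIntegral_ofReal, Complex.ofReal_re]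
  refine setIntegral_mono_on (integrableOn_rpow_mul_psiReal r)
    (integrableOn_rpow_mul_psiReal r') measurableSet_Ioi fun x hx => ?_
  have hx1 : 1 < x := hx
  have := (Real.exp_pos _).le.trans (exp_le_psiReal hx1.le)
  gcongr
  exact hx1.le

theorem norm_lavrikIntegral_le (s : ℂ) : ‖lavrikIntegral s‖ ≤ (lavrikIntegral (s.re : ℂ)).re := by
  rw [lavrikIntegral_ofReal, Complex.ofReal_re, lavrikIntegral_eq]
  refine norm_integral_le_of_norm_le (integrableOn_rpow_mul_psiReal _) ?_
  refine (ae_restrict_mem measurableSet_Ioi).mono fun x hx => le_of_eq ?_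
  have hx1 : 1 < x := hx
  have hx0 : (0 : ℝ) < x := one_pos.trans hx
  have := (Real.exp_pos _).le.trans (exp_le_psiReal hx1.le)
  rw [norm_div, norm_mul, psiFn_ofReal hx0, Complex.norm_cpow_eq_rpow_re_of_pos hx0,
    Complex.norm_real, Complex.norm_real, Real.norm_of_nonneg this, Real.norm_of_nonneg hx0.le,
    Real.rpow_sub hx0, Real.rpow_one, show (s / 2).re = s.re / 2 by simp]
  ring

/-! ### Numerical bounds -/

theorem exp_neg_pi_mem_Ioo : Real.exp (-Real.pi) ∈ Ioo (0.043213 : ℝ) 0.043215 := by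
  have h1 := Real.pi_gt_d6
  have h2 := Real.pi_lt_d6
  have e1 := Real.exp_one_gt_d9
  have e2 := Real.exp_one_lt_d9
  have hexp : Real.exp Real.pi = Real.exp 1 ^ 3 * Real.exp (Real.pi - 3) := by
    rw [← Real.exp_nat_mul, ← Real.exp_add]
    congr 1
    push_cast
    ring
  have hu : Real.exp (Real.pi - 3) < 1.15212 := by
    have : Real.exp (Real.pi - 3) ≤ Real.exp 0.141593 := Real.exp_le_exp.mpr (by linarith)
    have h3 := Real.exp_bound' (x := 0.141593) (by norm_num) (by norm_num) (n := 5) (by norm_num)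
    norm_num [Finset.sum_range_succ, Nat.factorial] at h3
    linarith
  have hl : 1.15209 < Real.exp (Real.pi - 3) := by
    have : Real.exp 0.141592 ≤ Real.exp (Real.pi - 3) := Real.exp_le_exp.mpr (by linarith)
    have h3 := Real.sum_le_exp_of_nonneg (x := 0.141592) (by norm_num) 5
    norm_num [Finset.sum_range_succ, Nat.factorial] at h3
    linarith
  rw [Real.exp_neg, hexp]
  constructor
  · rw [lt_inv_comm₀ (by norm_num) (by positivity)]
    calc Real.exp 1 ^ 3 * Real.exp (Real.pi - 3) < 2.7182818286 ^ 3 * 1.15212 := by gcongr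
      _ < _ := by norm_num
  · rw [inv_lt_comm₀ (by positivity) (by norm_num)]
    calc (0.043215 : ℝ)⁻¹ < 2.7182818283 ^ 3 * 1.15209 := by norm_num
      _ < _ := by gcongr

theorem incGamma_le_of_le {a u v : ℝ} (h : (a - 1) * incGamma (a - 1) ≤ u)
    (hv : 0.043215 + u ≤ 3.141592 * v) : incGamma a ≤ v := by
  have h1 := pi_mul_incGamma a
  have h2 := exp_neg_pi_mem_Ioo.2
  nlinarith [Real.pi_gt_d6, incGamma_nonneg a]

theorem le_incGamma_of_le {a u v : ℝ} (h : u ≤ (a - 1) * incGamma (a - 1))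
    (hv : 3.141593 * v ≤ 0.043213 + u) : v ≤ incGamma a := by
  have h1 := pi_mul_incGamma a
  have h2 := exp_neg_pi_mem_Ioo.1
  nlinarith [Real.pi_lt_d6, incGamma_nonneg a]

theorem incGamma_step_le {a b u v : ℝ} (hb : b = a - 1) (ha : 0 ≤ b) (h : incGamma b ≤ u)
    (hv : 0.043215 + b * u ≤ 3.141592 * v) : incGamma a ≤ v := by
  subst hb
  exact incGamma_le_of_le (mul_le_mul_of_nonneg_left h ha) hv

theorem le_incGamma_step {a b u v : ℝ} (hb : b = a - 1) (ha : 0 ≤ b) (h : u ≤ incGamma b)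
    (hv : 3.141593 * v ≤ 0.043213 + b * u) : v ≤ incGamma a := by
  subst hb
  exact le_incGamma_of_le (mul_le_mul_of_nonneg_left h ha) hv

/-- A negative multiplier b in the recursion exchanges upper and lower bounds. -/
theorem incGamma_step_le_of_neg {a b u v : ℝ} (hb : b = a - 1) (ha : b ≤ 0) (h : u ≤ incGamma b)
    (hv : 0.043215 + b * u ≤ 3.141592 * v) : incGamma a ≤ v := by
  subst hb
  exact incGamma_le_of_le (mul_le_mul_of_nonpos_left h ha) hv

theorem le_incGamma_step_of_neg {a b u v : ℝ} (hb : b = a - 1) (ha : b ≤ 0) (h : incGamma b ≤ u)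
    (hv : 3.141593 * v ≤ 0.043213 + b * u) : v ≤ incGamma a := by
  subst hb
  exact le_incGamma_of_le (mul_le_mul_of_nonpos_left h ha) hv

/-- 5.6225 = 11.245/2. The recursion starts from the trivial bound `0 ≤ incGamma (-2.3775)`; three
steps with negative multiplier turn this lower bound into an upper one. The initial error is
multiplied by |b|/π at each step, so it ends up small. -/
theorem incGamma_upper : incGamma 5.6225 ≤ 0.08874 := by
  have h8 : incGamma (-1.3775) ≤ 0.013756 :=
    incGamma_step_le_of_neg (b := -2.3775) (by norm_num) (by norm_num) (incGamma_nonneg _)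
      (by norm_num)
  have h7 : 0.007723 ≤ incGamma (-0.3775) :=
    le_incGamma_step_of_neg (by norm_num) (by norm_num) h8 (by norm_num)
  have h6 : incGamma 0.6225 ≤ 0.012828 :=
    incGamma_step_le_of_neg (by norm_num) (by norm_num) h7 (by norm_num)
  have h5 : incGamma 1.6225 ≤ 0.016298 :=
    incGamma_step_le (by norm_num) (by norm_num) h6 (by norm_num)
  have h4 : incGamma 2.6225 ≤ 0.022173 :=
    incGamma_step_le (by norm_num) (by norm_num) h5 (by norm_num)
  have h3 : incGamma 3.6225 ≤ 0.032266 :=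
    incGamma_step_le (by norm_num) (by norm_num) h4 (by norm_num)
  have h2 : incGamma 4.6225 ≤ 0.050961 :=
    incGamma_step_le (by norm_num) (by norm_num) h3 (by norm_num)
  exact incGamma_step_le (by norm_num) (by norm_num) h2 (by norm_num)

/-- 5.6275 = 11.255/2. Here two steps with negative multiplier, starting at -1.3725, keep the
direction of the trivial bound. -/
theorem incGamma_lower : 0.088894 ≤ incGamma 5.6275 := by
  have h7 : incGamma (-0.3725) ≤ 0.013756 :=
    incGamma_step_le_of_neg (b := -1.3725) (by norm_num) (by norm_num) (incGamma_nonneg _)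
      (by norm_num)
  have h6 : 0.012124 ≤ incGamma 0.6275 :=
    le_incGamma_step_of_neg (by norm_num) (by norm_num) h7 (by norm_num)
  have h5 : 0.016176 ≤ incGamma 1.6275 :=
    le_incGamma_step (by norm_num) (by norm_num) h6 (by norm_num)
  have h4 : 0.022135 ≤ incGamma 2.6275 :=
    le_incGamma_step (by norm_num) (by norm_num) h5 (by norm_num)
  have h3 : 0.032267 ≤ incGamma 3.6275 :=
    le_incGamma_step (by norm_num) (by norm_num) h4 (by norm_num)
  have h2 : 0.051012 ≤ incGamma 4.6275 :=
    le_incGamma_step (by norm_num) (by norm_num) h3 (by norm_num)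
  exact le_incGamma_step (by norm_num) (by norm_num) h2 (by norm_num)

/-! ### The function F: growth and order -/

/-- The entire function `s Λ(s)`. -/
noncomputable def lavrikF (s : ℂ) : ℂ := -1 + s * lavrikIntegral s

theorem differentiable_lavrikF : Differentiable ℂ lavrikF :=
  (differentiable_const _).add (differentiable_id.mul differentiable_lavrikIntegral)

theorem lavrikF_eq_mul_lavrikLambda {s : ℂ} (hs : ∀ n : ℕ, s ≠ -2 * (n : ℂ)) :
    lavrikF s = s * lavrikLambda s := by
  have h0 : s ≠ 0 := by simpa using hs 0
  rw [lavrikLambda, lavrikL_equation 1 s hs, lavrikF, lavrikIntegral_eq]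
  simp only [Complex.one_cpow, one_mul]
  field_simp

theorem lavrikF_zero : lavrikF 0 = -1 := by simp [lavrikF]

theorem hasDerivAt_lavrikF (s : ℂ) :
    HasDerivAt lavrikF (lavrikIntegral s + s * deriv lavrikIntegral s) s := by
  have := ((hasDerivAt_id s).mul (differentiable_lavrikIntegral s).hasDerivAt).const_add (-1)
  simp only [id, one_mul] at this
  exact this

theorem logDeriv_lavrikF_zero : logDeriv lavrikF 0 = -lavrikAlpha := by
  rw [logDeriv_apply, (hasDerivAt_lavrikF 0).deriv, lavrikF_zero, lavrikIntegral_zero]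
  simp [div_neg]

theorem lavrikF_conj (s : ℂ) : lavrikF (starRingEnd ℂ s) = starRingEnd ℂ (lavrikF s) := by
  simp [lavrikF, lavrikIntegral_conj]

theorem lavrikF_ofReal (r : ℝ) :
    lavrikF r = ((-1 + r * (lavrikIntegral r).re : ℝ) : ℂ) := by
  rw [lavrikF, lavrikIntegral_ofReal]
  push_cast
  rw [Complex.ofReal_re]

theorem norm_lavrikF_le {s : ℂ} (hs : 4 ≤ ‖s‖) : ‖lavrikF s‖ ≤ Real.exp (‖s‖ * Real.log ‖s‖) := by
  set r := ‖s‖ with hr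
  have hr0 : 0 < r := by linarith
  have h1 : ‖lavrikIntegral s‖ ≤ 10000 / 9999 * (r / 2) ^ (r / 2) :=
    (norm_lavrikIntegral_le s).trans <| (lavrikIntegral_mono (Complex.re_le_norm s)).trans <|
      (lavrikIntegral_le_incGamma _).trans
        (mul_le_mul_of_nonneg_left (incGamma_le_rpow_self (by positivity)) (by norm_num))
  have h2 : (r / 2) ^ (r / 2) ≤ r ^ (r / 2) := by
    gcongr
    linarith
  have h3 : r ^ 2 ≤ r ^ (r / 2) := by
    rw [← Real.rpow_natCast]
    apply Real.rpow_le_rpow_of_exponent_le <;> (push_cast; linarith)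
  have h4 : ‖lavrikF s‖ ≤ 1 + r * ‖lavrikIntegral s‖ := by
    refine (norm_add_le _ _).trans ?_
    rw [norm_neg, norm_one, norm_mul]
  -- One factor p = r^{r/2} bounds the integral; the other, being at least r² ≥ 4r, absorbs the
  -- polynomial factor in 1 + 2rp ≤ p².
  have h5 : Real.exp (r * Real.log r) = r ^ (r / 2) * r ^ (r / 2) := by
    rw [← Real.rpow_add hr0, Real.rpow_def_of_pos hr0]
    congr 1
    ring
  rw [h5]
  set p := r ^ (r / 2)
  have h6 : ‖lavrikIntegral s‖ ≤ 2 * p := by nlinarith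
  nlinarith [mul_le_mul_of_nonneg_left h6 hr0.le]

theorem eventually_norm_lavrikF_le {ρ : ℝ} (hρ : 1 < ρ) :
    ∀ᶠ z in Bornology.cobounded ℂ, ‖lavrikF z‖ ≤ Real.exp (‖z‖ ^ ρ) := by
  have hlog := (isLittleO_log_rpow_atTop (r := ρ - 1) (by linarith)).bound one_pos
  filter_upwards [tendsto_norm_cobounded_atTop.eventually hlog,
    tendsto_norm_cobounded_atTop.eventually_ge_atTop 4] with z hz hz4
  refine (norm_lavrikF_le hz4).trans (Real.exp_le_exp.mpr ?_)
  have hz0 : 0 < ‖z‖ := by linarith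
  rw [one_mul, Real.norm_of_nonneg (Real.log_nonneg (by linarith)),
    Real.norm_of_nonneg (by positivity)] at hz
  calc ‖z‖ * Real.log ‖z‖ ≤ ‖z‖ * ‖z‖ ^ (ρ - 1) := by gcongr
    _ = ‖z‖ ^ ρ := by
      rw [Real.rpow_sub_one hz0.ne']
      field_simp

theorem eventually_exp_mul_lt_norm_lavrikF (A : ℝ) :
    ∀ᶠ r : ℝ in atTop, Real.exp (A * r) < ‖lavrikF r‖ := by
  obtain ⟨c, hc, hcK⟩ := exists_mul_rpow_le_incGamma (K := Real.exp (max A 1))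
    (Real.one_le_exp (by positivity))
  -- r ≥ 2/c yields two copies of the exponential, one of which pays for the -1 in F.
  filter_upwards [eventually_gt_atTop 0, eventually_ge_atTop (2 / c)] with r hr hrc
  have h1 := (hcK r hr.le).trans (incGamma_le_lavrikIntegral r)
  rw [← Real.exp_mul] at h1
  rw [lavrikF_ofReal, Complex.norm_real]
  refine lt_of_lt_of_le ?_ (le_abs_self _)
  have h2 : Real.exp (A * r) ≤ Real.exp (max A 1 * r) :=
    Real.exp_le_exp.mpr (mul_le_mul_of_nonneg_right (le_max_left _ _) hr.le)
  have h3 : 1 < Real.exp (max A 1 * r) := Real.one_lt_exp_iff.mpr (by positivity)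
  rw [div_le_iff₀ hc] at hrc
  set E := Real.exp (max A 1 * r)
  have h4 : 2 * E ≤ r * (lavrikIntegral r).re := by
    calc 2 * E ≤ (r * c) * E := by gcongr
      _ = r * (c * E) := by ring
      _ ≤ _ := by gcongr
  linarith

theorem entireOrder_lavrikF : entireOrder lavrikF = 1 := by
  refine le_antisymm (ENNReal.le_of_forall_pos_le_add fun ε hε _ => ?_)
    (le_iInf₂ fun ρ hρ => ?_)
  · refine (iInf₂_le (1 + ε) (eventually_norm_lavrikF_le ?_)).trans (by simp)
    have : (0 : ℝ) < ε := hε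
    push_cast
    linarith
  · by_contra! hlt
    have hρ1 : (ρ : ℝ) < 1 := by exact_mod_cast hlt
    have hT : Tendsto (fun r : ℝ => (r : ℂ)) atTop (Bornology.cobounded ℂ) := by
      rw [← comap_norm_atTop, tendsto_comap_iff]
      exact tendsto_abs_atTop_atTop.congr fun r => by simp
    obtain ⟨r, h1, h2, h3⟩ := ((hT.eventually hρ).and
      ((eventually_exp_mul_lt_norm_lavrikF 1).and (eventually_gt_atTop 1))).exists
    have h4 := h2.trans_le h1
    rw [Real.exp_lt_exp, one_mul, Complex.norm_real, Real.norm_of_nonneg (by linarith)] at h4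
    have h5 := Real.rpow_le_rpow_of_exponent_le h3.le hρ1.le
    rw [Real.rpow_one] at h5
    linarith

/-! ### The real zero -/

theorem lavrikIntegral_re_pos {r : ℝ} (hr : 0 ≤ r) : 0 < (lavrikIntegral r).re := by
  obtain ⟨c, hc, h⟩ := exists_mul_rpow_le_incGamma (K := 1) le_rfl
  have := (h r hr).trans (incGamma_le_lavrikIntegral r)
  rw [Real.one_rpow, mul_one] at this
  linarith

theorem pos_of_lavrikF_ofReal_eq_zero {r : ℝ} (h : lavrikF r = 0) : 0 < r := by
  rw [lavrikF_ofReal, Complex.ofReal_eq_zero] at h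
  by_contra! hr
  have : 0 ≤ (lavrikIntegral r).re := (incGamma_nonneg _).trans (incGamma_le_lavrikIntegral r)
  nlinarith

theorem exists_real_zero :
    ∃ b₀ : ℝ, (∀ x : ℝ, lavrikF (x : ℂ) = 0 ↔ x = b₀) ∧ |b₀ - 11.25| < 0.005 := by
  have hcont : Continuous fun r : ℝ => -1 + r * (lavrikIntegral r).re := by
    have := differentiable_lavrikIntegral.continuous
    fun_prop
  have hlo : -1 + (11.245 : ℝ) * (lavrikIntegral (11.245 : ℝ)).re < 0 := by
    have h := lavrikIntegral_le_incGamma 11.245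
    rw [show (11.245 / 2 : ℝ) = 5.6225 by norm_num] at h
    have := incGamma_upper
    linarith
  have hhi : 0 < -1 + (11.255 : ℝ) * (lavrikIntegral (11.255 : ℝ)).re := by
    have h := incGamma_le_lavrikIntegral 11.255
    rw [show (11.255 / 2 : ℝ) = 5.6275 by norm_num] at h
    have := incGamma_lower
    linarith
  obtain ⟨b₀, hb, hb0⟩ := intermediate_value_Ioo (by norm_num) hcont.continuousOn ⟨hlo, hhi⟩
  refine ⟨b₀, fun x => ?_, by rw [abs_lt]; constructor <;> linarith [hb.1, hb.2]⟩
  simp only at hb0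
  have hb1 : (0 : ℝ) < b₀ := by linarith [hb.1]
  constructor
  · intro hx
    have hx0 := pos_of_lavrikF_ofReal_eq_zero hx
    rw [lavrikF_ofReal, Complex.ofReal_eq_zero] at hx
    rcases lt_trichotomy x b₀ with h | h | h
    · have h1 := lavrikIntegral_mono h.le
      have h2 := lavrikIntegral_re_pos hb1.le
      simp only at h1
      nlinarith
    · exact h
    · have h1 := lavrikIntegral_mono h.le
      have h2 := lavrikIntegral_re_pos hx0.le
      simp only at h1
      nlinarith
  · rintro rfl
    rw [lavrikF_ofReal, hb0, Complex.ofReal_zero]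

/-- F'(r) = I(r) + r I'(r) > 0, since r > 0, I(r) > 0 and I is monotone on the real axis. -/
theorem analyticOrderAt_lavrikF_of_real_zero {r : ℝ} (h : lavrikF r = 0) :
    analyticOrderAt lavrikF r = 1 := by
  refine (differentiable_lavrikF.analyticAt _).analyticOrderAt_eq_one_of_zero_deriv_ne_zero h ?_
  have hr := pos_of_lavrikF_ofReal_eq_zero h
  have h1 := (differentiable_lavrikIntegral (r : ℂ)).hasDerivAt.real_of_complex
  have h2 : 0 ≤ (deriv lavrikIntegral r).re := h1.deriv ▸ lavrikIntegral_mono.deriv_nonneg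
  rw [(hasDerivAt_lavrikF r).deriv]
  intro h3
  have h4 := congrArg Complex.re h3
  rw [Complex.add_re, Complex.re_ofReal_mul, Complex.zero_re] at h4
  have := lavrikIntegral_re_pos hr.le
  have := mul_nonneg hr.le h2
  linarith

/-! ### Conjugation, and indexing zeros with multiplicity -/

theorem analyticOrderAt_conj {F : ℂ → ℂ} (hF : Differentiable ℂ F)
    (hconj : ∀ s, F (starRingEnd ℂ s) = starRingEnd ℂ (F s)) (z : ℂ) :
    analyticOrderAt F (starRingEnd ℂ z) = analyticOrderAt F z := by
  have key : ∀ (n : ℕ) (w : ℂ), (n : ℕ∞) ≤ analyticOrderAt F w →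
      (n : ℕ∞) ≤ analyticOrderAt F (starRingEnd ℂ w) := by
    intro n w h
    rw [natCast_le_analyticOrderAt (hF.analyticAt _)] at h ⊢
    obtain ⟨g, hg, hgF⟩ := h
    refine ⟨fun s => starRingEnd ℂ (g (starRingEnd ℂ s)), ?_, ?_⟩
    · rw [Complex.analyticAt_iff_eventually_differentiableAt] at hg ⊢
      have := (Complex.continuous_conj.tendsto' (starRingEnd ℂ w) w (by simp)).eventually hg
      filter_upwards [this] with s hs
      have h2 := hs.conj_conj
      rwa [Complex.conj_conj] at h2
    · have := (Complex.continuous_conj.tendsto' (starRingEnd ℂ w) w (by simp)).eventually hgF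
      filter_upwards [this] with s hs
      rw [hconj] at hs
      have h2 := congrArg (starRingEnd ℂ) hs
      simpa using h2
  refine le_antisymm ?_ ?_
  · refine ENat.forall_natCast_le_iff_le.mp fun n hn => ?_
    simpa using key n _ hn
  · exact ENat.forall_natCast_le_iff_le.mp fun n hn => key n _ hn

/-- The zeros of `F` in `U`, indexed with multiplicity. -/
def ZeroIndex (F : ℂ → ℂ) (U : Set ℂ) : Type :=
  {p : ℂ × ℕ // p.1 ∈ U ∧ (p.2 : ℕ∞) < analyticOrderAt F p.1}

/-- The zero belonging to an index. -/
def ZeroIndex.point {F : ℂ → ℂ} {U : Set ℂ} (i : ZeroIndex F U) : ℂ := i.1.1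

theorem ZeroIndex.encard_fiber {F : ℂ → ℂ} {U : Set ℂ} {z : ℂ} (hz : z ∈ U)
    (hfin : analyticOrderAt F z ≠ ⊤) :
    {i : ZeroIndex F U | i.point = z}.encard = analyticOrderAt F z := by
  obtain ⟨n, hn⟩ := ENat.ne_top_iff_exists.mp hfin
  let f : Fin n → ZeroIndex F U := fun k => ⟨(z, k), hz, by rw [← hn]; exact_mod_cast k.2⟩
  have hf : Function.Injective f := fun k l hkl => by
    have := congrArg (fun i : ZeroIndex F U => i.1.2) hkl
    exact Fin.ext this
  have hrange : {i : ZeroIndex F U | i.point = z} = range f := by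
    ext ⟨⟨w, k⟩, hw, hk⟩
    constructor
    · intro hwz
      obtain rfl : w = z := hwz
      rw [← hn] at hk
      exact ⟨⟨k, by exact_mod_cast hk⟩, rfl⟩
    · rintro ⟨l, hl⟩
      exact (congrArg (fun i : ZeroIndex F U => i.1.1) hl).symm
  rw [hrange, ← image_univ, hf.encard_image, ← hn]
  simp

theorem ListsZeros.point {F : ℂ → ℂ} (hF : Differentiable ℂ F) (h0 : F 0 ≠ 0) :
    ListsZeros F (ZeroIndex.point : ZeroIndex F univ → ℂ) where
  differentiable := hF
  map_zero := h0
  encard z := ZeroIndex.encard_fiber (mem_univ z)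
    (AnalyticOnNhd.analyticOrderAt_ne_top_of_isPreconnected
      (fun z _ => hF.analyticAt z) isPreconnected_univ (mem_univ 0) (mem_univ z)
      (by rw [((hF.analyticAt 0).analyticOrderAt_eq_zero).mpr h0]; simp))

theorem ZeroIndex.exists_point_eq {F : ℂ → ℂ} (hF : Differentiable ℂ F) {U : Set ℂ} {z : ℂ}
    (hz : z ∈ U) (h0 : F z = 0) : ∃ i : ZeroIndex F U, i.point = z :=
  ⟨⟨(z, 0), hz, by
    rw [Nat.cast_zero, pos_iff_ne_zero]
    exact (hF.analyticAt z).analyticOrderAt_ne_zero.mpr h0⟩, rfl⟩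

theorem ZeroIndex.finite_norm_le {F : ℂ → ℂ} (hF : Differentiable ℂ F) (h0 : F 0 ≠ 0)
    (U : Set ℂ) (R : ℝ) : {i : ZeroIndex F U | ‖i.point‖ ≤ R}.Finite := by
  let f : ZeroIndex F U → ZeroIndex F univ := fun i => ⟨i.1, mem_univ _, i.2.2⟩
  have hf : Function.Injective f := fun i j hij =>
    Subtype.ext (congrArg (fun k : ZeroIndex F univ => k.1) hij)
  exact ((ListsZeros.point hF h0).finite_norm_le R).preimage (f := f) hf.injOn

/-! ### Infinitely many non-real zeros -/

/-- An entire function of genus at most one with finitely many zeros has exponential type. -/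
theorem ListsZeros.exists_norm_le_exp {ι : Type*} [Finite ι] {F : ℂ → ℂ} {b : ι → ℂ}
    (h : ListsZeros F b) {ρ : ℝ} (hρ : ρ < 2)
    (hgrow : ∀ᶠ z in Bornology.cobounded ℂ, ‖F z‖ ≤ Real.exp (‖z‖ ^ ρ)) :
    ∃ A : ℝ, ∀ s, ‖F s‖ ≤ ‖F 0‖ * Real.exp (A * ‖s‖) := by
  cases nonempty_fintype ι
  -- Each factor satisfies |(1 - w)e^w| ≤ e^{2|w|} with w = s/b_i.
  refine ⟨‖logDeriv F 0‖ + ∑ i, 2 / ‖b i‖, fun s => ?_⟩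
  rw [h.eq_exp_mul_tprod hρ hgrow Summable.of_finite s, tprod_fintype, mul_assoc, norm_mul,
    norm_mul, norm_prod, add_mul, Real.exp_add, Finset.sum_mul, Real.exp_sum]
  have hexp : ∀ w : ℂ, ‖Complex.exp w‖ ≤ Real.exp ‖w‖ := fun w => by
    rw [Complex.norm_exp]
    exact Real.exp_le_exp.mpr (Complex.re_le_norm w)
  gcongr with i
  · rw [← norm_mul]
    exact hexp _
  · rw [norm_mul, show 2 / ‖b i‖ * ‖s‖ = ‖s / b i‖ + ‖s / b i‖ by rw [norm_div]; ring,
      Real.exp_add]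
    gcongr
    · refine (norm_sub_le _ _).trans ?_
      rw [norm_one, add_comm]
      exact Real.add_one_le_exp _
    · exact hexp _

theorem infinite_nonreal_zeros : {z : ℂ | lavrikF z = 0 ∧ z.im ≠ 0}.Infinite := by
  intro hfin
  have h0 : lavrikF 0 ≠ 0 := by simp [lavrikF_zero]
  have hL := ListsZeros.point differentiable_lavrikF h0
  obtain ⟨b₀, hb₀, -⟩ := exists_real_zero
  obtain ⟨R, hR⟩ := ((hfin.union (finite_singleton (b₀ : ℂ))).image norm).bddAbove
  have : Finite (ZeroIndex lavrikF univ) := by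
    rw [← finite_univ_iff]
    refine (hL.finite_norm_le R).subset fun i _ => hR (mem_image_of_mem _ ?_)
    have hi := hL.apply_eq_zero i
    by_cases him : i.point.im = 0
    · right
      have hre : i.point = (i.point.re : ℂ) := by
        apply Complex.ext <;> simp [him]
      rw [hre] at hi ⊢
      rw [(hb₀ _).mp hi, mem_singleton_iff]
    · exact Or.inl ⟨hi, him⟩
  obtain ⟨A, hA⟩ := hL.exists_norm_le_exp (ρ := 3 / 2) (by norm_num)
    (eventually_norm_lavrikF_le (by norm_num))
  obtain ⟨r, h1, h2⟩ := ((eventually_exp_mul_lt_norm_lavrikF A).and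
    (eventually_ge_atTop (0 : ℝ))).exists
  have h3 := hA r
  rw [lavrikF_zero, Complex.norm_real, Real.norm_of_nonneg h2, norm_neg, norm_one, one_mul] at h3
  linarith

/-! ### Numbering the zeros -/

/-- Break ties of `f` by an injection into ℕ. Each element then has finitely many predecessors;
their number is an injective rank, and its infinite range in ℕ is enumerated in order. -/
theorem exists_equiv_nat_monotone {T : Type*} [Infinite T] (f : T → ℝ)
    (hf : ∀ R, {t | f t ≤ R}.Finite) : ∃ e : ℕ ≃ T, Monotone (f ∘ e) := by
  classical
  have hc : Countable T := by
    rw [← countable_univ_iff]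
    refine (countable_iUnion fun n : ℕ => (hf n).countable).mono fun t _ => ?_
    obtain ⟨n, hn⟩ := exists_nat_ge (f t)
    exact mem_iUnion.mpr ⟨n, hn⟩
  obtain ⟨c, hc⟩ := exists_injective_nat T
  let g : T → ℝ ×ₗ ℕ := fun t => toLex (f t, c t)
  have hg : Function.Injective g := fun s t hst => by
    have := congrArg (fun p => (ofLex p).2) hst
    exact hc this
  have hgf : ∀ s t, g s ≤ g t → f s ≤ f t := fun s t hst => by
    rcases Prod.Lex.toLex_le_toLex.mp hst with h | h
    · exact h.le
    · exact h.1.le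
  let r : T → ℕ := fun t => {s | g s < g t}.ncard
  have hr : ∀ s t, g s < g t → r s < r t := fun s t hst => by
    refine ncard_lt_ncard ⟨fun u hu => lt_trans hu hst, fun hsub => ?_⟩
      ((hf (f t)).subset fun u hu => hgf _ _ (le_of_lt hu))
    exact lt_irrefl (g s) (hsub hst)
  have hinj : Function.Injective r := fun s t hst => by
    rcases lt_trichotomy (g s) (g t) with h | h | h
    · exact absurd hst (hr _ _ h).ne
    · exact hg h
    · exact absurd hst (hr _ _ h).ne'
  let e₁ : T ≃ range r := Equiv.ofInjective r hinj
  have : Infinite (range r) := Infinite.of_injective e₁ e₁.injective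
  let e₂ : ℕ ≃o range r := Nat.Subtype.orderIsoOfNat (range r)
  refine ⟨e₂.toEquiv.trans e₁.symm, fun m n hmn => hgf _ _ ?_⟩
  by_contra! hlt
  have h1 := hr _ _ hlt
  have h2 : ∀ k, r (e₁.symm (e₂ k)) = e₂ k := fun k =>
    congrArg Subtype.val (e₁.apply_symm_apply (e₂ k))
  have h3 : e₂ m ≤ e₂ n := e₂.monotone hmn
  have h4 : r (e₁.symm (e₂ n)) < r (e₁.symm (e₂ m)) := h1
  rw [h2, h2] at h4
  exact absurd h4 (not_lt.mpr h3)

/-- The two-sided sequence with the given value at `0`, `u` at positive and its conjugate at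
negative indices. -/
def conjExtend (b₀ : ℂ) (u : ℕ → ℂ) : ℤ → ℂ
  | Int.ofNat 0 => b₀
  | Int.ofNat (n + 1) => u n
  | Int.negSucc n => starRingEnd ℂ (u n)

/-- Sort the zeros of the upper half-plane by modulus and reflect them. Conjugation preserves
multiplicities, and the real zero is simple, so one index suffices for it. -/
theorem exists_isZeroNumbering : ∃ b : ℤ → ℂ, IsZeroNumbering lavrikF b := by
  have hd := differentiable_lavrikF
  have h0 : lavrikF 0 ≠ 0 := by simp [lavrikF_zero]
  set U : Set ℂ := {z | 0 < z.im} with hU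
  have hinf : Infinite (ZeroIndex lavrikF U) := by
    by_contra hfin
    rw [not_infinite_iff_finite] at hfin
    have h1 := finite_range (ZeroIndex.point : ZeroIndex lavrikF U → ℂ)
    refine infinite_nonreal_zeros ((h1.union (h1.image (starRingEnd ℂ))).subset ?_)
    rintro z ⟨hz, him⟩
    rcases lt_or_gt_of_ne him with h | h
    · right
      obtain ⟨i, hi⟩ := ZeroIndex.exists_point_eq hd (U := U) (z := starRingEnd ℂ z)
        (by simpa [hU] using h) (by rw [lavrikF_conj, hz, map_zero])
      exact ⟨_, ⟨i, rfl⟩, by rw [hi, Complex.conj_conj]⟩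
    · exact Or.inl (ZeroIndex.exists_point_eq hd (U := U) h hz)
  obtain ⟨e, he⟩ := exists_equiv_nat_monotone
    (fun i : ZeroIndex lavrikF U => ‖i.point‖) (ZeroIndex.finite_norm_le hd h0 U)
  obtain ⟨b₀, hb₀, -⟩ := exists_real_zero
  set u : ℕ → ℂ := fun n => (e n).point with hu
  have him : ∀ n, 0 < (u n).im := fun n => (e n).2.1
  have hfiber : ∀ z ∈ U, {n | u n = z}.encard = analyticOrderAt lavrikF z := fun z hz => by
    rw [← ZeroIndex.encard_fiber (U := U) hz ((ListsZeros.point hd h0).order_ne_top z),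
      ← e.injective.encard_image]
    congr 1
    ext i
    simp only [hu, mem_image, mem_ofPred_eq]
    exact ⟨by rintro ⟨n, hn, rfl⟩; exact hn, fun hi => ⟨e.symm i, by simpa using hi, by simp⟩⟩
  refine ⟨conjExtend b₀ u, ?_, ?_, ?_, ?_, ?_⟩
  · exact Complex.ofReal_im b₀
  · rintro ((_ | n) | n) hn
    · exact absurd rfl hn
    · exact (him n).ne'
    · simpa [conjExtend] using (him n).ne'
  · rintro ((_ | n) | n)
    · exact (Complex.conj_ofReal b₀).symm
    · rfl
    · exact (Complex.conj_conj (u n)).symm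
  · rintro ((_ | n) | n) hn
    · exact absurd hn (by norm_num)
    · exact he n.le_succ
    · exact absurd hn (by omega)
  · intro z
    rcases lt_trichotomy z.im 0 with h | h | h
    · rw [← analyticOrderAt_conj hd lavrikF_conj,
        ← hfiber (starRingEnd ℂ z) (by simpa [hU] using h),
        ← (show Function.Injective Int.negSucc from
          fun _ _ h => Int.negSucc.inj h).encard_image]
      congr 1
      ext n
      simp only [mem_image, mem_ofPred_eq]
      constructor
      · intro hn
        rcases n with ((_ | n) | n)
        · rw [← hn] at h
          exact absurd h (by simp [conjExtend])
        · rw [← hn] at h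
          exact absurd h (him n).not_gt
        · exact ⟨n, by rw [← hn]; exact (Complex.conj_conj _).symm, rfl⟩
      · rintro ⟨k, hk, rfl⟩
        simp [conjExtend, hk]
    · obtain ⟨x, rfl⟩ : ∃ x : ℝ, z = x := ⟨z.re, by apply Complex.ext <;> simp [h]⟩
      have hsub : {n : ℤ | conjExtend b₀ u n = x} ⊆ {0} := by
        rintro ((_ | n) | n) hn
        · rfl
        · have : u n = x := hn
          have h1 := him n
          simp [this] at h1
        · have : starRingEnd ℂ (u n) = x := hn
          have h1 := him n
          rw [← Complex.conj_conj (u n), this] at h1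
          simp at h1
      by_cases hx : lavrikF x = 0
      · rw [analyticOrderAt_lavrikF_of_real_zero hx]
        have : {n : ℤ | conjExtend b₀ u n = x} = {0} :=
          hsub.antisymm (by rintro _ rfl; rw [(hb₀ x).mp hx]; rfl)
        rw [this, encard_singleton]
      · rw [(hd.analyticAt _).analyticOrderAt_eq_zero.mpr hx, encard_eq_zero,
          eq_empty_iff_forall_notMem]
        intro n hn
        have hn0 := hsub hn
        rw [mem_singleton_iff] at hn0
        subst hn0
        have : (b₀ : ℂ) = x := hn
        exact hx ((hb₀ x).mpr (by exact_mod_cast this.symm))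
    · rw [← hfiber z h,
        ← (show Function.Injective fun n : ℕ => Int.ofNat (n + 1) from
          fun m n h => by simpa using h).encard_image]
      congr 1
      ext n
      simp only [mem_image, mem_ofPred_eq]
      constructor
      · intro hn
        rcases n with ((_ | n) | n)
        · rw [← hn] at h
          exact absurd h (by simp [conjExtend])
        · exact ⟨n, hn, rfl⟩
        · rw [← hn] at h
          exact absurd h (by simpa [conjExtend] using (him n).le)
      · rintro ⟨k, hk, rfl⟩
        exact hk

/-! ### Summability of |b_n|⁻² and conclusion -/

theorem IsZeroNumbering.listsZeros {F : ℂ → ℂ} {b : ℤ → ℂ} (hb : IsZeroNumbering F b)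
    (hF : Differentiable ℂ F) (h0 : F 0 ≠ 0) : ListsZeros F b :=
  ⟨hF, h0, hb.multiplicity⟩

theorem IsZeroNumbering.norm_le_norm {F : ℂ → ℂ} {b : ℤ → ℂ} (hb : IsZeroNumbering F b)
    {m n : ℤ} (hm : 1 ≤ m) (hmn : m ≤ n) : ‖b m‖ ≤ ‖b n‖ := by
  induction n, hmn using Int.leInduction with
  | base => exact le_rfl
  | succ n hn ih => exact ih.trans (hb.monotone n (hm.trans hn))

/-- The disc of radius R = |b_n| contains b_1, …, b_n, so the Jensen-type bound gives n =
O(R^{4/3}), that is |b_n|⁻² = O(n^{-3/2}). -/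
theorem IsZeroNumbering.summable {F : ℂ → ℂ} {b : ℤ → ℂ} (hb : IsZeroNumbering F b)
    (hF : Differentiable ℂ F) (h0 : F 0 ≠ 0)
    (hgrow : ∀ᶠ z in Bornology.cobounded ℂ, ‖F z‖ ≤ Real.exp (‖z‖ ^ (4 / 3 : ℝ))) :
    Summable fun n => (‖b n‖ ^ 2)⁻¹ := by
  have hL := hb.listsZeros hF h0
  have hF0 : 0 < ‖F 0‖ := norm_pos_iff.mpr h0
  have hnat : Summable fun n : ℕ => (‖b n‖ ^ 2)⁻¹ := by
    obtain ⟨r, hr⟩ : ∃ r : ℝ, ∀ z : ℂ, r ≤ ‖z‖ → ‖F z‖ ≤ Real.exp (‖z‖ ^ (4 / 3 : ℝ)) := by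
      rw [← comap_norm_atTop, eventually_comap] at hgrow
      obtain ⟨r, hr⟩ := eventually_atTop.mp hgrow
      exact ⟨r, fun z hz => hr _ hz z rfl⟩
    have hev : ∀ᶠ n : ℕ in atTop, max r 1 < ‖b n‖ := by
      have := (Nat.cast_injective (R := ℤ)).tendsto_cofinite.eventually
        (hL.finite_norm_le (max r 1)).eventually_cofinite_notMem
      rw [Nat.cofinite_eq_atTop] at this
      filter_upwards [this] with n hn
      simpa using hn
    -- 72 = 8 · 9, from (n/4)^{3/2} = n^{3/2}/8 ≤ (3R)². The n/4 is what remains of n log 2 once n ≥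
    -- -4 log ‖F 0‖.
    have hC : ∀ᶠ n : ℕ in atTop, (‖b n‖ ^ 2)⁻¹ ≤ 72 * (1 / (n : ℝ) ^ (3 / 2 : ℝ)) := by
      filter_upwards [hev, eventually_gt_atTop 0, tendsto_natCast_atTop_atTop.eventually_ge_atTop
        (-4 * Real.log ‖F 0‖)] with n hn hn0 hnlog
      have hn0' : (0 : ℝ) < n := by exact_mod_cast hn0
      set R := ‖b n‖
      have hRr : r < R := (le_max_left _ _).trans_lt hn
      have hR1 : 1 < R := (le_max_right _ _).trans_lt hn
      have h1 := hL.norm_mul_two_pow_le (S := Finset.Icc (1 : ℤ) n) (R := R)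
        (M := Real.exp ((3 * R) ^ (4 / 3 : ℝ))) (by linarith)
        (fun i hi => hb.norm_le_norm (Finset.mem_Icc.mp hi).1 (Finset.mem_Icc.mp hi).2)
        (fun z hz => by rw [← hz]; exact hr z (by linarith))
      have h2 := Real.log_le_log (by positivity) h1
      rw [Real.log_mul hF0.ne' (by positivity), Real.log_pow, Real.log_exp] at h2
      simp only [Int.card_Icc, add_sub_cancel_right, Int.toNat_natCast] at h2
      have h3 : (n : ℝ) / 4 ≤ (3 * R) ^ (4 / 3 : ℝ) := by
        nlinarith [Real.log_two_gt_d9]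
      have h4 := Real.rpow_le_rpow (by positivity) h3 (by norm_num : (0 : ℝ) ≤ 3 / 2)
      rw [← Real.rpow_mul (by positivity), Real.div_rpow hn0'.le (by norm_num),
        show (4 / 3 * (3 / 2) : ℝ) = 2 by norm_num, Real.rpow_two,
        show (4 : ℝ) ^ (3 / 2 : ℝ) = 8 by
          rw [show (4 : ℝ) = 2 ^ (2 : ℝ) by norm_num, ← Real.rpow_mul (by norm_num)]
          norm_num] at h4
      rw [mul_one_div, le_div_iff₀ (by positivity), inv_mul_le_iff₀ (by positivity)]
      linarith
    refine Summable.of_norm_bounded_eventually_nat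
      ((Real.summable_one_div_nat_rpow.mpr (by norm_num : (1 : ℝ) < 3 / 2)).mul_left 72) ?_
    filter_upwards [hC] with n hn
    rwa [Real.norm_of_nonneg (by positivity)]
  refine summable_int_iff_summable_nat_and_neg.mpr ⟨hnat, hnat.congr fun n => ?_⟩
  rw [hb.conj, Complex.norm_conj]

theorem theoremT :
    ∃ F : ℂ → ℂ,
      -- `s π^{-s/2} Γ(s/2) 𝓛(s)` is an entire function `F`, of order `1`
      Differentiable ℂ F ∧
      (∀ s : ℂ, (∀ n : ℕ, s ≠ -2 * (n : ℂ)) → F s = s * lavrikLambda s) ∧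
      entireOrder F = 1 ∧
      -- it has exactly one real zero, which is `≈ 11.25`
      (∃ b₀ : ℝ, (∀ x : ℝ, F (x : ℂ) = 0 ↔ x = b₀) ∧ |b₀ - 11.25| < 0.005) ∧
      -- it has infinitely many non-real zeros, and all zeros can be numbered as `(b_n)_{n ∈ ℤ}`
      {z : ℂ | F z = 0 ∧ z.im ≠ 0}.Infinite ∧
      (∃ b : ℤ → ℂ, IsZeroNumbering F b) ∧
      -- the infinite product, for every such numbering
      IntegrableOn (fun y : ℝ => psiFn y / y) (Set.Ioi 1) ∧
      ∀ b : ℤ → ℂ, IsZeroNumbering F b → ∀ s : ℂ,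
        Multipliable (fun n : ℤ => (1 - s / b n) * Complex.exp (s / b n)) ∧
        F s = -Complex.exp (-lavrikAlpha * s) *
          ∏' n : ℤ, (1 - s / b n) * Complex.exp (s / b n) ∧
        ((∀ n : ℕ, s ≠ -2 * (n : ℂ)) →
          lavrikLambda s = -(Complex.exp (-lavrikAlpha * s) / s) *
            ∏' n : ℤ, (1 - s / b n) * Complex.exp (s / b n)) := by
  have h0 : lavrikF 0 ≠ 0 := by simp [lavrikF_zero]
  refine ⟨lavrikF, differentiable_lavrikF, fun s => lavrikF_eq_mul_lavrikLambda,
    entireOrder_lavrikF, exists_real_zero, infinite_nonreal_zeros, exists_isZeroNumbering,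
    by simpa using integrableOn_lavrikIntegral 0, fun b hb s => ?_⟩
  have hgrow := eventually_norm_lavrikF_le (ρ := 4 / 3) (by norm_num)
  have hsum := hb.summable differentiable_lavrikF h0 hgrow
  have hprod := (hb.listsZeros differentiable_lavrikF h0).eq_exp_mul_tprod (by norm_num) hgrow hsum s
  rw [lavrikF_zero, logDeriv_lavrikF_zero, neg_one_mul] at hprod
  refine ⟨multipliable_genus_one_factor hsum s, hprod, fun hs => ?_⟩
  have hs0 : s ≠ 0 := by simpa using hs 0
  rw [lavrikF_eq_mul_lavrikLambda hs] at hprod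
  rw [← mul_right_inj' hs0, hprod]
  field_simp
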